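/- Let $K$ be a field and $A$ an infinite totally ordered alphabet (of order type $\omega$). A word $u$ over $\{1,2,\dots\}$ is packed if its set of letters is $\{1,\dots,p\}$ for some $p$; $\mathrm{PW}(n)$ is the set of packed words of length $n$, and $\mathrm{pack}(w)$ is obtained from a word $w$ over a totally ordered alphabet by replacing all occurrences of its $k$-th smallest letter by $k$. Let $\mathbf{WQSym}$ be the span, with coefficients in $K(t)$, of the noncommutative formal series $\mathbf M_u=\mathbf M_u(A)=\sum_{\mathrm{pack}(w)=u}w$ for $u$ packed. The partial products $\prec,\circ,\succ$ on $\mathbf{WQSym}$ are induced by the bilinear operations on series for which, for nonempty words $x,y$, the word $x\prec y$ (resp. $x\circ y$, $x\succ y$) is the concatenation $xy$ if $\max(x)>\max(y)$ (resp. $\max(x)=\max(y)$, $\max(x)<\max(y)$) and $0$ otherwise. Let $(\mathbf N_u)$ be the basis of the graded dual $\mathbf{WQSym}^*$ dual to $(\mathbf M_u)$, with internal product $\mathbf N_u*\mathbf N_v=\mathbf N_{\mathrm{pack}(u,v)}$ if $|u|=|v|$ (biletters being ordered lexicographically) and $0$ otherwise. The noncommutative symmetric functions embed in $\mathbf{WQSym}^*$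 by $S^I\mapsto\sum_{\mathrm{ev}(u)=I}\mathbf N_u$, where $\mathrm{ev}(u)$ is the composition whose $k$-th part is the number of occurrences of $k$ in $u$. Put $\Lambda_k=\sum_{I\vDash k}(-1)^{k-\ell(I)}S^I$ and $\sigma_1((1-t)A)=\big(\sum_k(-t)^k\Lambda_k\big)\big(\sum_kS_k\big)$, and let $\eta_t(\mathbf N_u)=\mathbf N_u*\sigma_1((1-t)A)$. Its adjoint $\eta_t^*$ on $\mathbf{WQSym}$ is written $f(A)\mapsto f(A\cdot(1-t))$. The specialization $f\mapsto f(\mathbb X)$, with $\mathbb X=\frac1{1-q}\,\hat\times\,(1-t)$, is the linear map obtained by applying $\eta_t^*$ and then replacing $A$ by the alphabet $\frac1{1-q}=\{\cdots<q^2<q<1\}$ of commuting letters; its values are formal power series in $q$ over $K(t)$, regarded as elements of the field $K(t)((q))$. For a nonempty packed word $w$, let $\mathrm{Nmax}(w)$ be the number of occurrences in $w$ of its maximal letter. **Theorem.** Let $n,m\ge1$, $u_1\in\mathrm{PW}(n)$ and $u_2\in\mathrm{PW}(m)$. Then $$(\mathbf M_{u_1}\prec\mathbf M_{u_2})(\mathbb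 X)=\frac{1-q^n}{1-q^{n+m}}\,\frac{q^m-t^{\mathrm{Nmax}(u_2)}}{1-t^{\mathrm{Nmax}(u_2)}}\,\mathbf M_{u_1}(\mathbb X)\,\mathbf M_{u_2}(\mathbb X),$$ $$(\mathbf M_{u_1}\circ\mathbf M_{u_2})(\mathbb X)=\frac{(1-q^n)(1-q^m)}{1-q^{n+m}}\,\frac{1-t^{\mathrm{Nmax}(u_1)+\mathrm{Nmax}(u_2)}}{(1-t^{\mathrm{Nmax}(u_1)})(1-t^{\mathrm{Nmax}(u_2)})}\,\mathbf M_{u_1}(\mathbb X)\,\mathbf M_{u_2}(\mathbb X),$$ $$(\mathbf M_{u_1}\succ\mathbf M_{u_2})(\mathbb X)=\frac{1-q^m}{1-q^{n+m}}\,\frac{q^n-t^{\mathrm{Nmax}(u_1)}}{1-t^{\mathrm{Nmax}(u_1)}}\,\mathbf M_{u_1}(\mathbb X)\,\mathbf M_{u_2}(\mathbb X).$$ -/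

import Mathlib

open scoped PowerSeries LaurentSeries

namespace WordQSym

/-! ### Words and packed words -/

section Words

variable {A : Type*} [LinearOrder A]

/-- The rank of the letter `a` among the distinct letters of the word `w`: it is `k` when `a` is the
`k`-th smallest letter of `w`. -/
def rank (w : List A) (a : A) : ℕ := (w.toFinset.filter (· ≤ a)).card

/-- The word obtained from `w` by replacing all occurrences of its `k`-th smallest letter by `k`. -/
def packList (w : List A) : List ℕ := w.map (rank w)

/-- A word over the positive integers is packed if its set of letters is `{1, …, p}` for some `p`
(the empty word is the packed word with `p = 0`). -/
def IsPacked (w : List ℕ) : Prop := ∃ p : ℕ, ∀ a : ℕ, a ∈ w ↔ 1 ≤ a ∧ a ≤ p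

/-- The type `PW` of packed words. -/
abbrev PackedWord : Type := {w : List ℕ // IsPacked w}

noncomputable instance : DecidableEq PackedWord := Classical.decEq _

theorem rank_strictMonoOn (w : List A) : StrictMonoOn (rank w) {a | a ∈ w} := by
  intro a _ b hb hab
  apply Finset.card_lt_card
  refine ⟨fun c hc => ?_, fun h => ?_⟩
  · simp only [Finset.mem_filter] at hc ⊢
    exact ⟨hc.1, hc.2.trans hab.le⟩
  · have : b ∈ w.toFinset.filter (· ≤ a) := h (by simpa using hb)
    simp only [Finset.mem_filter] at this
    exact absurd hab (not_lt.2 this.2)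

theorem isPacked_packList (w : List A) : IsPacked (packList w) := by
  refine ⟨w.toFinset.card, fun k => ?_⟩
  have himg : w.toFinset.image (rank w) = Finset.Icc 1 w.toFinset.card := by
    apply Finset.eq_of_subset_of_card_le
    · intro j hj
      obtain ⟨a, ha, rfl⟩ := Finset.mem_image.1 hj
      refine Finset.mem_Icc.2 ⟨Finset.card_pos.2 ⟨a, by simpa using ha⟩, ?_⟩
      exact Finset.card_le_card (Finset.filter_subset _ _)
    · rw [Finset.card_image_of_injOn, Nat.card_Icc]
      · omega
      · intro a ha b hb h
        exact (rank_strictMonoOn w).injOn (by simpa using ha) (by simpa using hb) h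
  have := congrArg (k ∈ ·) himg
  simpa [packList] using this

/-- The packed word `pack w` of a word `w` over a totally ordered alphabet. -/
def pack (w : List A) : PackedWord := ⟨packList w, isPacked_packList w⟩

@[simp] theorem length_packList (w : List A) : (packList w).length = w.length := by
  simp [packList]

theorem packList_map {B : Type*} [LinearOrder B] (f : A → B) (w : List A)
    (hf : StrictMonoOn f {a | a ∈ w}) : packList (w.map f) = packList w := by
  simp only [packList, List.map_map]
  refine List.map_congr_left fun a ha => ?_
  simp only [Function.comp, rank]
  have : ((w.map f).toFinset.filter (· ≤ f a)) = (w.toFinset.filter (· ≤ a)).image f := by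
    ext b
    simp only [Finset.mem_filter, List.mem_toFinset, List.mem_map, Finset.mem_image]
    constructor
    · rintro ⟨⟨c, hc, rfl⟩, hle⟩
      exact ⟨c, ⟨hc, (hf.le_iff_le hc ha).1 hle⟩, rfl⟩
    · rintro ⟨c, ⟨hc, hle⟩, rfl⟩
      exact ⟨⟨c, hc, rfl⟩, (hf.le_iff_le hc ha).2 hle⟩
  rw [this, Finset.card_image_of_injOn]
  intro x hx y hy h
  simp only [Finset.coe_filter, List.mem_toFinset, Set.mem_ofPred_eq] at hx hy
  exact hf.injOn hx.1 hy.1 h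

end Words

theorem packList_of_isPacked {w : List ℕ} (hw : IsPacked w) : packList w = w := by
  obtain ⟨p, hp⟩ := hw
  conv_rhs => rw [← List.map_id w]
  refine List.map_congr_left fun a ha => ?_
  have : w.toFinset.filter (· ≤ a) = Finset.Icc 1 a := by
    ext b
    have := (hp a).1 ha
    simp only [Finset.mem_filter, List.mem_toFinset, hp, Finset.mem_Icc]
    omega
  simp [rank, this]

@[simp] theorem pack_coe (u : PackedWord) : pack (u : List ℕ) = u :=
  Subtype.ext (packList_of_isPacked u.2)

theorem finite_packedWord_length (n : ℕ) : {u : PackedWord | u.1.length = n}.Finite := by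
  have hfin : {l : List (Fin (n + 1)) | l.length = n}.Finite := List.finite_length_eq _ n
  refine Set.Finite.subset (hfin.image fun l => pack (l.map Fin.val)) ?_
  intro u hu
  simp only [Set.mem_ofPred_eq] at hu
  obtain ⟨p, hp⟩ := u.2
  have hle : ∀ a ∈ u.1, a < n + 1 := by
    intro a ha
    have h1 : Finset.Icc 1 p ⊆ u.1.toFinset := fun b hb => by
      simpa [hp] using hb
    have h2 := Finset.card_le_card h1
    have h3 := List.toFinset_card_le u.1
    have h4 := ((hp a).1 ha).2
    simp at h2
    omega
  refine ⟨u.1.pmap (fun a h => ⟨a, h⟩) hle, by simpa using hu, ?_⟩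
  simp only [List.map_pmap]
  simp

/-- The finite set `PW(n)` of packed words of length `n`. -/
noncomputable def PW (n : ℕ) : Finset PackedWord := (finite_packedWord_length n).toFinset

@[simp] theorem mem_PW {n : ℕ} {u : PackedWord} : u ∈ PW n ↔ u.1.length = n := by
  simp [PW]

/-- The maximal letter of a word over the natural numbers (`0` for the empty word). -/
def maxLetter (w : List ℕ) : ℕ := w.foldr max 0

/-- The number of occurrences in `w` of its maximal letter. -/
def Nmax (w : List ℕ) : ℕ := w.count (maxLetter w)

/-- The evaluation of a packed word: the list of the numbers of occurrences of `1, 2, …, max u`. -/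
def ev (u : PackedWord) : List ℕ :=
  (List.range (maxLetter u.1)).map fun k => u.1.count (k + 1)

/-! ### Word quasi-symmetric functions and the three partial products -/

section WQSymDefs

variable (R : Type*) [CommRing R]

/-- Formal series in noncommuting variables indexed by the infinite totally ordered alphabet
`A = {0 < 1 < 2 < ⋯}`: the series `∑ f(w) w` is identified with its coefficient function `f`. -/
abbrev WordSeries : Type _ := List ℕ → R

/-- The series `M_u(A)`, the sum of all words `w` over `A` with `pack w = u`. -/
noncomputable def wordM (u : PackedWord) : WordSeries R := fun w => if pack w = u then 1 else 0

/-- `WQSym(A)`, the span of the series `M_u(A)`. -/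
def WQSym : Submodule R (WordSeries R) := Submodule.span R (Set.range (wordM R))

variable {R}

/-- Given a relation `r` between natural numbers, the bilinear operation on series which sends a pair
of nonempty words `(x, y)` to their concatenation if `r (max x) (max y)`, and to `0` otherwise
(it is zero if `x` or `y` is empty). -/
noncomputable def partialMul (r : ℕ → ℕ → Prop) [DecidableRel r] (f g : WordSeries R) :
    WordSeries R := fun w =>
  ∑ i ∈ Finset.Ioo 0 w.length,
    if r (maxLetter (w.take i)) (maxLetter (w.drop i)) then f (w.take i) * g (w.drop i) else 0

theorem mem_WQSym_iff {f : WordSeries R} : f ∈ WQSym R ↔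
    (∀ w, f (pack w).1 = f w) ∧ ∃ N, ∀ w : List ℕ, N < w.length → f w = 0 := by
  constructor
  · intro hf
    induction hf using Submodule.span_induction with
    | mem x hx =>
      obtain ⟨u, rfl⟩ := hx
      refine ⟨fun w => by simp [wordM], u.1.length, fun w hw => ?_⟩
      have : pack w ≠ u := by
        rintro rfl
        simp [pack] at hw
      simp [wordM, this]
    | zero => exact ⟨fun _ => rfl, 0, fun _ _ => rfl⟩
    | add x y _ _ hx hy =>
      obtain ⟨h1, N1, h2⟩ := hx
      obtain ⟨h3, N2, h4⟩ := hy
      refine ⟨fun w => by simp [h1, h3], max N1 N2, fun w hw => ?_⟩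
      simp [h2 w (by omega), h4 w (by omega)]
    | smul a x _ hx =>
      obtain ⟨h1, N1, h2⟩ := hx
      exact ⟨fun w => by simp [h1], N1, fun w hw => by simp [h2 w hw]⟩
  · rintro ⟨h1, N, h2⟩
    have : f = ∑ n ∈ Finset.range (N + 1), ∑ u ∈ PW n, f u.1 • wordM R u := by
      funext w
      have hlen : (pack w).1.length = w.length := length_packList w
      simp only [Finset.sum_apply, Pi.smul_apply, wordM, smul_eq_mul, mul_ite, mul_one, mul_zero,
        Finset.sum_ite_eq, mem_PW, h1, hlen, Finset.mem_range]
      by_cases hw : w.length < N + 1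
      · rw [if_pos hw]
      · rw [if_neg hw, h2 w (by omega)]
    rw [this]
    exact Submodule.sum_mem _ fun n _ => Submodule.sum_mem _ fun u _ =>
      Submodule.smul_mem _ _ (Submodule.subset_span ⟨u, rfl⟩)

theorem le_maxLetter {w : List ℕ} {a : ℕ} (ha : a ∈ w) : a ≤ maxLetter w := by
  induction w with
  | nil => simp at ha
  | cons b w ih =>
    rcases List.mem_cons.1 ha with rfl | h
    · simp [maxLetter]
    · have := ih h
      simp only [maxLetter, List.foldr_cons] at this ⊢
      omega

theorem maxLetter_mem {w : List ℕ} (hw : w ≠ []) : maxLetter w ∈ w := by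
  induction w with
  | nil => exact absurd rfl hw
  | cons b w ih =>
    by_cases h : w = []
    · subst h
      simp [maxLetter]
    · have := ih h
      simp only [maxLetter, List.foldr_cons] at this ⊢
      rcases max_choice b (w.foldr max 0) with h' | h' <;> rw [h'] <;> simp [this]

theorem maxLetter_map {w : List ℕ} (hw : w ≠ []) (f : ℕ → ℕ)
    (hf : StrictMonoOn f {a | a ∈ w}) : maxLetter (w.map f) = f (maxLetter w) := by
  apply le_antisymm
  · have h := maxLetter_mem (w := w.map f) (by simpa using hw)
    obtain ⟨a, ha, h⟩ := List.mem_map.1 h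
    rw [← h]
    exact (hf.le_iff_le ha (maxLetter_mem hw)).2 (le_maxLetter ha)
  · exact le_maxLetter (List.mem_map_of_mem (maxLetter_mem hw))

theorem partialMul_mem (r : ℕ → ℕ → Prop) [DecidableRel r]
    (hr : ∀ (s : Set ℕ) (φ : ℕ → ℕ), StrictMonoOn φ s → ∀ a ∈ s, ∀ b ∈ s, r (φ a) (φ b) ↔ r a b)
    {f g : WordSeries R} (hf : f ∈ WQSym R) (hg : g ∈ WQSym R) :
    partialMul r f g ∈ WQSym R := by
  obtain ⟨hf1, N1, hf2⟩ := mem_WQSym_iff.1 hf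
  obtain ⟨hg1, N2, hg2⟩ := mem_WQSym_iff.1 hg
  refine mem_WQSym_iff.2 ⟨fun w => ?_, N1 + N2, fun w hw => ?_⟩
  · have hmono := rank_strictMonoOn w
    have hsub1 : ∀ i, StrictMonoOn (rank w) {a | a ∈ w.take i} := fun i =>
      hmono.mono fun a ha => List.mem_of_mem_take ha
    have hsub2 : ∀ i, StrictMonoOn (rank w) {a | a ∈ w.drop i} := fun i =>
      hmono.mono fun a ha => List.mem_of_mem_drop ha
    have hp : ∀ (h : WordSeries R), (∀ w, h (pack w).1 = h w) → ∀ x : List ℕ,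
        StrictMonoOn (rank w) {a | a ∈ x} → h (x.map (rank w)) = h x := by
      intro h hh x hx
      rw [← hh (x.map (rank w)), ← hh x]
      simp only [pack, packList_map _ _ hx]
    simp only [partialMul, pack, length_packList]
    refine Finset.sum_congr rfl fun i hi => ?_
    rw [Finset.mem_Ioo] at hi
    have hn1 : w.take i ≠ [] := by
      intro h
      have := congrArg List.length h
      rw [List.length_take, List.length_nil] at this
      omega
    have hn2 : w.drop i ≠ [] := by
      intro h
      have := congrArg List.length h
      rw [List.length_drop, List.length_nil] at this
      omega
    simp only [packList, ← List.map_take, ← List.map_drop]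
    rw [maxLetter_map hn1 _ (hsub1 i), maxLetter_map hn2 _ (hsub2 i),
      hp f hf1 _ (hsub1 i), hp g hg1 _ (hsub2 i)]
    have := hr _ _ hmono _ (List.mem_of_mem_take (maxLetter_mem hn1)) _
      (List.mem_of_mem_drop (maxLetter_mem hn2))
    simp only [this]
  · refine Finset.sum_eq_zero fun i hi => ?_
    rw [Finset.mem_Ioo] at hi
    by_cases h : N1 < i
    · rw [hf2 (w.take i) (by rw [List.length_take]; omega)]
      simp
    · rw [hg2 (w.drop i) (by rw [List.length_drop]; omega)]
      simp

/-- The left partial product `f ≺ g` on `WQSym`: `x ≺ y = xy` if `max x > max y`, else `0`. -/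
noncomputable def prec (f g : WQSym R) : WQSym R :=
  ⟨partialMul (· > ·) f.1 g.1, partialMul_mem _ (fun _ _ h _ ha _ hb => by exact h.lt_iff_lt hb ha) f.2 g.2⟩

/-- The middle partial product on `WQSym`: `x ∘ y = xy` if `max x = max y`, else `0`. -/
noncomputable def mid (f g : WQSym R) : WQSym R :=
  ⟨partialMul (· = ·) f.1 g.1,
    partialMul_mem _ (fun _ _ h _ ha _ hb => h.injOn.eq_iff ha hb) f.2 g.2⟩

/-- The right partial product `f ≻ g` on `WQSym`: `x ≻ y = xy` if `max x < max y`, else `0`. -/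
noncomputable def succ (f g : WQSym R) : WQSym R :=
  ⟨partialMul (· < ·) f.1 g.1, partialMul_mem _ (fun _ _ h _ ha _ hb => h.lt_iff_lt ha hb) f.2 g.2⟩

theorem linearIndependent_wordM : LinearIndependent R (wordM R) := by
  rw [linearIndependent_iff]
  intro l hl
  ext u
  have := congrFun hl u.1
  rw [Finsupp.linearCombination_apply, Finsupp.sum, Finset.sum_apply] at this
  simp only [Pi.smul_apply, wordM, pack_coe, smul_eq_mul, mul_ite, mul_one, mul_zero,
    Finset.sum_ite_eq, Pi.zero_apply, Finsupp.mem_support_iff] at this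
  by_cases h : l u = 0
  · exact h
  · simp [h] at this

variable (R)

/-- The basis `(M_u)` of `WQSym`. -/
noncomputable def basisM : Module.Basis PackedWord R (WQSym R) :=
  Module.Basis.span linearIndependent_wordM

/-- The element `M_u` of `WQSym`. -/
noncomputable def M (u : PackedWord) : WQSym R :=
  ⟨wordM R u, Submodule.subset_span ⟨u, rfl⟩⟩

theorem basisM_apply (u : PackedWord) : basisM R u = M R u :=
  Module.Basis.span_apply linearIndependent_wordM u

/-! ### The graded dual, noncommutative symmetric functions and the transformation `A ↦ (1 - t)A` -/

/-- The graded dual `WQSym^*`, with basis `N_u` dual to `M_u`. -/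
abbrev WQSymDual : Type _ := PackedWord →₀ R

/-- The basis element `N_u` of the graded dual. -/
noncomputable def N (u : PackedWord) : WQSymDual R := Finsupp.single u 1

/-- The duality pairing, for which `⟨M_u, N_v⟩ = δ_{u,v}`. -/
noncomputable def pairing : WQSym R →ₗ[R] WQSymDual R →ₗ[R] R :=
  (basisM R).constr R fun u => Finsupp.lapply u

/-- The packed word of the biword with rows `u` and `v`, biletters being ordered
lexicographically. -/
def packPair (u v : PackedWord) : PackedWord :=
  pack (List.zipWith (fun a b => toLex (a, b)) u.1 v.1)

variable {R} in
/-- The internal product of `WQSym^*`: `N_u * N_v = N_{pack(u,v)}` if `u` and `v` have the same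
length, and `0` otherwise. -/
noncomputable def internalMul (f g : WQSymDual R) : WQSymDual R :=
  f.sum fun u a => g.sum fun v b =>
    if u.1.length = v.1.length then (a * b) • N R (packPair u v) else 0

/-- The algebra `Sym` of noncommutative symmetric functions: the free associative algebra on
`S_1, S_2, …`; the word `i_1 ⋯ i_r` stands for `S^I = S_{i_1} ⋯ S_{i_r}`. -/
abbrev NSym : Type _ := MonoidAlgebra R (FreeMonoid ℕ+)

/-- The complete function `S_n`, with `S_0 = 1`. -/
noncomputable def completeS (n : ℕ) : NSym R :=
  if h : 0 < n then MonoidAlgebra.of R (FreeMonoid ℕ+) (FreeMonoid.of ⟨n, h⟩) else 1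

/-- The elementary function `Λ_n = ∑_{I ⊨ n} (-1)^{n - ℓ(I)} S^I`. -/
noncomputable def elementaryL (n : ℕ) : NSym R :=
  ∑ I : Composition n, (-1 : R) ^ (n - I.length) • (I.blocks.map (completeS R)).prod

variable {R} in
/-- The component of degree `n` of `σ_1((1-t)A) = λ_{-t}(A) σ_1(A)`, where
`λ_{-t}(A) = ∑_k (-t)^k Λ_k` and `σ_1(A) = ∑_k S_k`. -/
noncomputable def sigmaOneSub (t : R) (n : ℕ) : NSym R :=
  ∑ k ∈ Finset.range (n + 1), (-t) ^ k • (elementaryL R k * completeS R (n - k))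

/-- The embedding of `Sym` into `WQSym^*`, `S^I ↦ ∑_{ev(u) = I} N_u`. -/
noncomputable def symEmbed (x : NSym R) : WQSymDual R :=
  x.coeff.sum fun I c =>
    c • ∑ u ∈ (PW ((I.toList.map PNat.val).sum)).filter (fun u => ev u = I.toList.map PNat.val),
      N R u

variable {R}

/-- The linear map `η_t` of `WQSym^*`, `N_u ↦ N_u((1-t)A) = N_u * σ_1((1-t)A)` (only the component
of degree `|u|` of the right factor contributes). -/
noncomputable def eta (t : R) : WQSymDual R →ₗ[R] WQSymDual R :=
  Finsupp.linearCombination R fun u => internalMul (N R u) (symEmbed R (sigmaOneSub t u.1.length))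

/-- The adjoint `η_t^*` of `η_t`, `M_w ↦ M_w(A · (1-t))`. -/
noncomputable def etaStar (t : R) : WQSym R →ₗ[R] WQSym R :=
  (basisM R).constr R fun w => ∑ u ∈ PW w.1.length, eta t (N R u) w • M R u

theorem internalMul_apply_eq_zero (u w : PackedWord) (g : WQSymDual R)
    (h : w.1.length ≠ u.1.length) : internalMul (N R u) g w = 0 := by
  rw [internalMul, N, Finsupp.sum_single_index (by simp), Finsupp.sum, Finsupp.finsetSum_apply]
  refine Finset.sum_eq_zero fun v _ => ?_
  split_ifs with hl
  · have : packPair u v ≠ w := by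
      rintro rfl
      apply h
      simp [packPair, pack, hl]
    simp [N, this]
  · rfl

/-- `η_t^*` is the adjoint of `η_t` for the duality pairing. -/
theorem pairing_etaStar (t : R) (f : WQSym R) (g : WQSymDual R) :
    pairing R (etaStar t f) g = pairing R f (eta t g) := by
  suffices h : pairing R ∘ₗ etaStar t = (pairing R).compl₂ (eta t) by
    simpa using LinearMap.congr_fun₂ h f g
  refine (basisM R).ext fun w => Finsupp.lhom_ext' fun u => LinearMap.ext_ring ?_
  simp only [LinearMap.comp_apply, LinearMap.compl₂_apply, etaStar, Module.Basis.constr_basis,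
    map_sum, map_smul, LinearMap.sum_apply, LinearMap.smul_apply, pairing, ← basisM_apply,
    Finsupp.lapply_apply, Finsupp.lsingle_apply, smul_eq_mul]
  simp only [Finsupp.single_apply, mul_ite, mul_one, mul_zero, Finset.sum_ite_eq, mem_PW]
  split_ifs with h
  · rfl
  · simp only [eta, Finsupp.linearCombination_single, one_smul]
    exact (internalMul_apply_eq_zero u w _ (Ne.symm h)).symm

/-! ### The specialization at `𝕏` -/

/-- `M_u(1/(1-q))`, as a power series in `q`: the value of the series `M_u(A)` when `A` is the
alphabet `{⋯ < q² < q < 1}` of commuting letters. A word over this alphabet is encoded by the list of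
the exponents of its letters, which are compared in the reverse order. -/
noncomputable def principalM (u : PackedWord) : R⟦X⟧ :=
  PowerSeries.mk fun d =>
    (Nat.card {w : List ℕ // pack (w.map OrderDual.toDual) = u ∧ w.sum = d} : R)

/-- The specialization `f ↦ f(1/(1-q))` of `WQSym`. -/
noncomputable def principal : WQSym R →ₗ[R] R⟦X⟧ :=
  (basisM R).constr R principalM

end WQSymDefs

section Specialization

variable (K : Type*) [Field K]

/-- The indeterminate `t`, in the field `K(t)((q))`. -/
noncomputable def t : (RatFunc K)⸨X⸩ := HahnSeries.C RatFunc.X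

/-- The indeterminate `q`, in the field `K(t)((q))`. -/
noncomputable def q : (RatFunc K)⸨X⸩ := ((PowerSeries.X : (RatFunc K)⟦X⟧) : (RatFunc K)⸨X⸩)

variable {K}

/-- The specialization `f ↦ f(𝕏)` of `WQSym` at `𝕏 = 1/(1-q) ×̂ (1-t)`: apply `A ↦ A · (1-t)`,
then set `A = 1/(1-q)`. -/
noncomputable def atX (f : WQSym (RatFunc K)) : (RatFunc K)⸨X⸩ :=
  ((principal (etaStar RatFunc.X f) : (RatFunc K)⟦X⟧) : (RatFunc K)⸨X⸩)

end Specialization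

end WordQSym

namespace WordQSym

/-! ### Layerings -/

/-! The proof rests on a closed form of M_w(𝕏), `atX_M`. Let w be packed of length n with largest
letter p + 1, let c_k be the multiplicity of k in w, and s_k = c_1 + ⋯ + c_k. Then M_w(𝕏) is (1 -
t^{c_{p+1}}) / (1 - q^n) times the product over k ≤ p of (q^{s_k} - t^{c_k}) / (1 - q^{s_k}).

To obtain it, note that the coefficient of q^d is a sum over pairs (x, v), where x is a word of
exponents of sum d and v is a packed word with pack(pack x, v) = w. Such an x is w with a weakly
decreasing sequence g substituted for its letters, and the admissible v are the layerings of the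
letters of w that increase wherever g is constant. The coefficient of N_v in σ₁((1-t)A) depends only
on the length, the maximal letter of v and its multiplicity. Summing it over layerings
(`sum_layerings_coeff`) leaves a weight that factors over letters: 1 - t^{c_i} at the end of each
constant run of g, and -t^{c_i} elsewhere. The sum over g then follows a two-term recursion
(`sum_antiSeqs_succ`, `map_descentSeries`).

A partial product of M_{u₁} and M_{u₂} is the sum of the M_w for which w has a prefix packing to u₁,
a suffix packing to u₂, and the required comparison of maxima. These w are the layerings of two
disjoint chains, the letters of u₁ and those of u₂, and the comparison prescribes the highest level
S. In the closed form the maximal letter contributes a factor depending only on S. The lower levels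
contribute a sum over layerings of the complement of S, which `sum_layerProd` evaluates as a product
over the two chains. Each chain returns the product occurring in M_{u_i}(𝕏), with one more factor if
its top is not in S; this is `atX_partialMul`, and the three formulas are the three nonempty choices
of S.

The layering identities come from removing the highest level, which can be any nonempty set of fibre
tops: a sum over all such subsets is the expansion of a product, with the empty set left out. -/

/-- A layering of the finite set `T` puts its elements on consecutive levels `1, 2, …, r`, so that the
levels strictly increase along each fibre of `g`. It is extended by `0` outside `T`. -/
def IsLayering (g : ℕ → ℕ) (T : Finset ℕ) (f : ℕ → ℕ) : Prop :=
  (∀ i ∉ T, f i = 0) ∧ (∀ i ∈ T, 0 < f i) ∧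
    (∀ i ∈ T, ∀ k, 0 < k → k ≤ f i → ∃ j ∈ T, f j = k) ∧
    ∀ i ∈ T, ∀ j ∈ T, i < j → g i = g j → f i < f j

theorem finite_bounded_support (T : Finset ℕ) (B : ℕ) :
    {f : ℕ → ℕ | (∀ i ∉ T, f i = 0) ∧ ∀ i ∈ T, f i ≤ B}.Finite := by
  refine (Set.finite_range fun (F : T → Fin (B + 1)) (i : ℕ) =>
    if h : i ∈ T then (F ⟨i, h⟩ : ℕ) else 0).subset ?_
  rintro f ⟨h0, hB⟩
  refine ⟨fun i => ⟨f i, Nat.lt_succ_of_le (hB i i.2)⟩, ?_⟩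
  funext i
  by_cases h : i ∈ T
  · simp [h]
  · simp [h, h0 i h]

/-- No level below `f i` is skipped, so `T` surjects onto them. This bound makes the set of
layerings finite. -/
theorem IsLayering.le_card {g : ℕ → ℕ} {T : Finset ℕ} {f : ℕ → ℕ} (hf : IsLayering g T f)
    {i : ℕ} (hi : i ∈ T) : f i ≤ T.card := by
  have h : Finset.Icc 1 (f i) ⊆ T.image f := fun k hk => by
    rw [Finset.mem_Icc] at hk
    obtain ⟨j, hj, rfl⟩ := hf.2.2.1 i hi k hk.1 hk.2
    exact Finset.mem_image_of_mem f hj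
  simpa using (Finset.card_le_card h).trans Finset.card_image_le

theorem finite_isLayering (g : ℕ → ℕ) (T : Finset ℕ) : {f | IsLayering g T f}.Finite :=
  (finite_bounded_support T T.card).subset fun _ hf => ⟨hf.1, fun _ hi => hf.le_card hi⟩

/-- The finite set of layerings of `T`. -/
noncomputable def layerings (g : ℕ → ℕ) (T : Finset ℕ) : Finset (ℕ → ℕ) :=
  (finite_isLayering g T).toFinset

@[simp] theorem mem_layerings {g : ℕ → ℕ} {T : Finset ℕ} {f : ℕ → ℕ} :
    f ∈ layerings g T ↔ IsLayering g T f := by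
  simp [layerings]

/-- The elements of `T` which are maximal in their fibre of `g`. -/
def tops (g : ℕ → ℕ) (T : Finset ℕ) : Finset ℕ := T.filter fun i => ∀ j ∈ T, i < j → g i ≠ g j

/-- The elements of `T` on the highest level. -/
def topLayer (T : Finset ℕ) (f : ℕ → ℕ) : Finset ℕ := T.filter fun i => f i = T.sup f

/-- The map obtained from a layering of `T \ S` by adding `S` as a new highest level. -/
def addTop (T S : Finset ℕ) (f : ℕ → ℕ) : ℕ → ℕ :=
  fun i => if i ∈ S then (T \ S).sup f + 1 else f i

theorem tops_subset (g : ℕ → ℕ) (T : Finset ℕ) : tops g T ⊆ T := Finset.filter_subset _ _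

theorem tops_nonempty (g : ℕ → ℕ) {T : Finset ℕ} (hT : T.Nonempty) : (tops g T).Nonempty :=
  ⟨T.max' hT, Finset.mem_filter.2 ⟨T.max'_mem hT, fun j hj h =>
    absurd (T.le_max' j hj) (not_le.2 h)⟩⟩

theorem topLayer_nonempty {T : Finset ℕ} (hT : T.Nonempty) (f : ℕ → ℕ) :
    (topLayer T f).Nonempty := by
  obtain ⟨i, hi, h⟩ := Finset.exists_mem_eq_sup T hT f
  exact ⟨i, Finset.mem_filter.2 ⟨hi, h.symm⟩⟩

/-- A later element of the same fibre would lie on a strictly higher level. -/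
theorem IsLayering.topLayer_subset {g : ℕ → ℕ} {T : Finset ℕ} {f : ℕ → ℕ}
    (hf : IsLayering g T f) : topLayer T f ⊆ tops g T := by
  intro i hi
  obtain ⟨hi, h⟩ := Finset.mem_filter.1 hi
  refine Finset.mem_filter.2 ⟨hi, fun j hj hij hg => ?_⟩
  have h1 := hf.2.2.2 i hi j hj hij hg
  have h2 := Finset.le_sup (f := f) hj
  omega

section AddTop

variable {T S : Finset ℕ} {f : ℕ → ℕ}

theorem addTop_of_mem {i : ℕ} (hi : i ∈ S) : addTop T S f i = (T \ S).sup f + 1 := if_pos hi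

theorem addTop_of_notMem {i : ℕ} (hi : i ∉ S) : addTop T S f i = f i := if_neg hi

theorem sup_addTop (hS : S ⊆ T) (hne : S.Nonempty) :
    T.sup (addTop T S f) = (T \ S).sup f + 1 := by
  apply le_antisymm
  · refine Finset.sup_le fun i hi => ?_
    by_cases h : i ∈ S
    · rw [addTop_of_mem h]
    · rw [addTop_of_notMem h]
      have := Finset.le_sup (f := f) (Finset.mem_sdiff.2 ⟨hi, h⟩)
      omega
  · obtain ⟨i, hi⟩ := hne
    rw [← addTop_of_mem (T := T) (f := f) hi]
    exact Finset.le_sup (f := addTop T S f) (hS hi)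

theorem topLayer_addTop (hS : S ⊆ T) (hne : S.Nonempty) : topLayer T (addTop T S f) = S := by
  ext i
  rw [topLayer, Finset.mem_filter, sup_addTop hS hne]
  constructor
  · rintro ⟨hi, h⟩
    by_contra hiS
    rw [addTop_of_notMem hiS] at h
    have := Finset.le_sup (f := f) (Finset.mem_sdiff.2 ⟨hi, hiS⟩)
    omega
  · exact fun hi => ⟨hS hi, addTop_of_mem hi⟩

theorem IsLayering.exists_of_le_sup {g : ℕ → ℕ} (hf : IsLayering g T f) {k : ℕ} (hk : 0 < k)
    (hk' : k ≤ T.sup f) : ∃ j ∈ T, f j = k := by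
  have hT : T.Nonempty := by
    rw [Finset.nonempty_iff_ne_empty]
    rintro rfl
    simp at hk'
    omega
  obtain ⟨i, hi, h⟩ := Finset.exists_mem_eq_sup T hT f
  exact hf.2.2.1 i hi k hk (h ▸ hk')

/-- Since `S` consists of fibre tops, nothing in a fibre comes after an element of `S`, so a new
level above all others keeps the fibres increasing. -/
theorem IsLayering.addTop {g : ℕ → ℕ} (hS : S ⊆ tops g T) (hf : IsLayering g (T \ S) f) :
    IsLayering g T (addTop T S f) := by
  have hST : S ⊆ T := hS.trans (tops_subset g T)
  refine ⟨fun i hi => ?_, fun i hi => ?_, fun i hi k hk hki => ?_, fun i hi j hj hij hg => ?_⟩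
  · rw [addTop_of_notMem fun h => hi (hST h)]
    exact hf.1 i fun h => hi (Finset.mem_sdiff.1 h).1
  · by_cases h : i ∈ S
    · rw [addTop_of_mem h]
      omega
    · rw [addTop_of_notMem h]
      exact hf.2.1 i (Finset.mem_sdiff.2 ⟨hi, h⟩)
  · by_cases hk' : k ≤ (T \ S).sup f
    · obtain ⟨j, hj, rfl⟩ := hf.exists_of_le_sup hk hk'
      rw [Finset.mem_sdiff] at hj
      exact ⟨j, hj.1, addTop_of_notMem hj.2⟩
    · by_cases h : i ∈ S
      · rw [addTop_of_mem h] at hki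
        exact ⟨i, hi, by rw [addTop_of_mem h]; omega⟩
      · rw [addTop_of_notMem h] at hki
        have := Finset.le_sup (f := f) (Finset.mem_sdiff.2 ⟨hi, h⟩)
        omega
  · have hiS : i ∉ S := fun h => (Finset.mem_filter.1 (hS h)).2 j hj hij hg
    rw [addTop_of_notMem hiS]
    have hi' := Finset.mem_sdiff.2 ⟨hi, hiS⟩
    by_cases h : j ∈ S
    · rw [addTop_of_mem h]
      have := Finset.le_sup (f := f) hi'
      omega
    · rw [addTop_of_notMem h]
      exact hf.2.2.2 i hi' j (Finset.mem_sdiff.2 ⟨hj, h⟩) hij hg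

end AddTop

theorem IsLayering.removeTop {g : ℕ → ℕ} {T : Finset ℕ} {f : ℕ → ℕ} (hf : IsLayering g T f) :
    IsLayering g (T \ topLayer T f) (fun i => if i ∈ topLayer T f then 0 else f i) := by
  refine ⟨fun i hi => ?_, fun i hi => ?_, fun i hi k hk hki => ?_, fun i hi j hj hij hg => ?_⟩
  · rw [Finset.mem_sdiff, not_and_not_right] at hi
    by_cases h : i ∈ T
    · simp [hi h]
    · simp [hf.1 i h]
  · rw [Finset.mem_sdiff] at hi
    simp only [hi.2, if_false]
    exact hf.2.1 i hi.1
  · rw [Finset.mem_sdiff] at hi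
    simp only [hi.2, if_false] at hki
    obtain ⟨j, hj, rfl⟩ := hf.2.2.1 i hi.1 k hk hki
    have hlt : f i < T.sup f := lt_of_le_of_ne (Finset.le_sup hi.1) fun h =>
      hi.2 (Finset.mem_filter.2 ⟨hi.1, h⟩)
    have hj' : j ∉ topLayer T f := fun h => by
      have := (Finset.mem_filter.1 h).2
      omega
    exact ⟨j, Finset.mem_sdiff.2 ⟨hj, hj'⟩, by simp [hj']⟩
  · rw [Finset.mem_sdiff] at hi hj
    simp only [hi.2, hj.2, if_false]
    exact hf.2.2.2 i hi.1 j hj.1 hij hg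

theorem IsLayering.addTop_removeTop {g : ℕ → ℕ} {T : Finset ℕ} {f : ℕ → ℕ}
    (hf : IsLayering g T f) (hT : T.Nonempty) :
    WordQSym.addTop T (topLayer T f) (fun i => if i ∈ topLayer T f then 0 else f i) = f := by
  have hsup := sup_addTop (f := fun i => if i ∈ topLayer T f then 0 else f i)
    (Finset.filter_subset _ _ : topLayer T f ⊆ T) (topLayer_nonempty hT f)
  set f' : ℕ → ℕ := fun i => if i ∈ topLayer T f then 0 else f i with hf'
  -- Levels are consecutive, so removing the highest one lowers the supremum by exactly one;
  -- `addTop` then puts the level back at its old height.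
  have key : (T \ topLayer T f).sup f' + 1 = T.sup f := by
    have hlt : ∀ i ∈ T \ topLayer T f, f' i < T.sup f := by
      intro i hi
      rw [Finset.mem_sdiff] at hi
      simp only [hf', hi.2, if_false]
      exact lt_of_le_of_ne (Finset.le_sup hi.1) fun h => hi.2 (Finset.mem_filter.2 ⟨hi.1, h⟩)
    obtain ⟨i, hi⟩ := hT
    have hpos : 0 < T.sup f := (hf.2.1 i hi).trans_le (Finset.le_sup hi)
    apply le_antisymm
    · exact (Finset.sup_lt_iff hpos).2 hlt
    · by_contra! hcon
      obtain ⟨j, hj, hjk⟩ := hf.exists_of_le_sup (k := (T \ topLayer T f).sup f' + 1)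
        (Nat.succ_pos _) hcon.le
      have hj' : j ∉ topLayer T f := fun h => by
        have := (Finset.mem_filter.1 h).2
        omega
      have := Finset.le_sup (f := f') (Finset.mem_sdiff.2 ⟨hj, hj'⟩)
      simp only [hf', hj', if_false] at this
      simp only [hf'] at hjk
      omega
  funext i
  by_cases h : i ∈ topLayer T f
  · rw [addTop_of_mem h, key, (Finset.mem_filter.1 h).2]
  · rw [addTop_of_notMem h]
    simp [hf', h]

/-! ### Sums over layerings by removal of the highest level -/

/-- The layerings of `T` with highest level `S` are the layerings of `T \ S` with `S` added on top. -/
theorem sum_layerings_topLayer_eq {R : Type*} [AddCommMonoid R] {g : ℕ → ℕ} {T S : Finset ℕ}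
    (hS : S ⊆ tops g T) (hne : S.Nonempty) (Φ : (ℕ → ℕ) → R) :
    ∑ f ∈ (layerings g T).filter (fun f => topLayer T f = S), Φ f =
      ∑ f ∈ layerings g (T \ S), Φ (addTop T S f) := by
  have hST : S ⊆ T := hS.trans (tops_subset g T)
  refine Finset.sum_nbij' (fun f i => if i ∈ S then 0 else f i) (addTop T S) ?_ ?_ ?_ ?_ ?_
  · intro f hf
    simp only [Finset.mem_filter, mem_layerings] at hf ⊢
    obtain ⟨hf, rfl⟩ := hf
    exact hf.removeTop
  · intro f hf
    simp only [Finset.mem_filter, mem_layerings] at hf ⊢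
    exact ⟨hf.addTop hS, topLayer_addTop hST hne⟩
  · intro f hf
    simp only [Finset.mem_filter, mem_layerings] at hf
    obtain ⟨hf, rfl⟩ := hf
    exact hf.addTop_removeTop (hne.mono hST)
  · intro f hf
    rw [mem_layerings] at hf
    funext i
    by_cases h : i ∈ S
    · simp [h, hf.1 i]
    · simp [h, addTop_of_notMem h]
  · intro f hf
    simp only [Finset.mem_filter, mem_layerings] at hf
    obtain ⟨hf, rfl⟩ := hf
    rw [hf.addTop_removeTop (hne.mono hST)]

/-- The recursion behind every layering identity: the highest level ranges over all nonempty sets of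
fibre tops, and what lies below it is an arbitrary layering of the rest. -/
theorem sum_layerings {R : Type*} [AddCommMonoid R] (g : ℕ → ℕ) {T : Finset ℕ}
    (hT : T.Nonempty) (Φ : (ℕ → ℕ) → R) :
    ∑ f ∈ layerings g T, Φ f =
      ∑ S ∈ (tops g T).powerset.erase ∅, ∑ f ∈ layerings g (T \ S), Φ (addTop T S f) := by
  rw [← Finset.sum_fiberwise_of_maps_to (g := topLayer T) (t := (tops g T).powerset.erase ∅)]
  · refine Finset.sum_congr rfl fun S hS => ?_
    rw [Finset.mem_erase, Finset.mem_powerset, ← Finset.nonempty_iff_ne_empty] at hS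
    exact sum_layerings_topLayer_eq hS.2 hS.1 Φ
  · intro f hf
    rw [mem_layerings] at hf
    rw [Finset.mem_erase, Finset.mem_powerset, ← Finset.nonempty_iff_ne_empty]
    exact ⟨topLayer_nonempty hT f, hf.topLayer_subset⟩

theorem layerings_empty (g : ℕ → ℕ) : layerings g ∅ = {0} := by
  ext f
  simp only [mem_layerings, IsLayering, Finset.mem_singleton]
  constructor
  · exact fun h => funext fun i => h.1 i (by simp)
  · rintro rfl
    simp

theorem sdiff_ssubset_of_mem {g : ℕ → ℕ} {T S : Finset ℕ}
    (hS : S ∈ (tops g T).powerset.erase ∅) : T \ S ⊂ T := by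
  rw [Finset.mem_erase, Finset.mem_powerset, ← Finset.nonempty_iff_ne_empty] at hS
  exact Finset.sdiff_ssubset (hS.2.trans (tops_subset g T)) hS.1

/-- The signed number of layerings of `T`. -/
theorem sum_layerings_neg_one_pow {R : Type*} [CommRing R] (g : ℕ → ℕ) (T : Finset ℕ) :
    ∑ f ∈ layerings g T, (-1 : R) ^ T.sup f = (-1) ^ T.card := by
  induction T using Finset.strongInduction with
  | H T ih =>
    rcases T.eq_empty_or_nonempty with rfl | hT
    · simp [layerings_empty]
    rw [sum_layerings g hT]
    have h1 : ∀ S ∈ (tops g T).powerset.erase ∅,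
        ∑ f ∈ layerings g (T \ S), (-1 : R) ^ T.sup (addTop T S f) =
          -(-1) ^ T.card * (-1) ^ S.card := by
      intro S hS
      have hss := sdiff_ssubset_of_mem hS
      rw [Finset.mem_erase, Finset.mem_powerset, ← Finset.nonempty_iff_ne_empty] at hS
      have hST := hS.2.trans (tops_subset g T)
      have hcard := Finset.card_sdiff_add_card_eq_card hST
      simp only [sup_addTop hST hS.1, pow_succ]
      rw [← Finset.sum_mul, ih _ hss, ← hcard, pow_add]
      have : (-1 : R) ^ S.card * (-1) ^ S.card = 1 := by rw [← mul_pow]; simp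
      linear_combination (-1 : R) ^ (T \ S).card * this
    -- The alternating sum over all subsets of the nonempty set of tops vanishes, so the nonempty
    -- subsets contribute minus the term of the empty set.
    rw [Finset.sum_congr rfl h1, ← Finset.mul_sum, Finset.sum_erase_eq_sub (by simp)]
    have h2 := Finset.prod_add (fun _ => (-1 : R)) (fun _ => 1) (tops g T)
    have h3 : (tops g T).card ≠ 0 := (tops_nonempty g hT).card_pos.ne'
    simp only [neg_add_cancel, Finset.prod_const, one_pow, mul_one, zero_pow h3] at h2
    rw [← h2]
    simp

/-- The sum over layerings of the coefficients of `σ₁((1-t)A)`. -/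
theorem sum_layerings_coeff {R : Type*} [CommRing R] (t : R) (a : ℕ → ℕ) (g : ℕ → ℕ)
    {T : Finset ℕ} (hT : T.Nonempty) :
    ∑ f ∈ layerings g T, (-1 : R) ^ (T.sup f + 1) * t ^ (∑ i ∈ T \ topLayer T f, a i) *
        (1 - t ^ (∑ i ∈ topLayer T f, a i)) =
      ∏ i ∈ T, if i ∈ tops g T then 1 - t ^ a i else -t ^ a i := by
  rw [sum_layerings g hT]
  have htT := tops_subset g T
  set P := tops g T with hP
  have h1 : ∀ S ∈ P.powerset.erase ∅, ∑ f ∈ layerings g (T \ S),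
      (-1 : R) ^ (T.sup (addTop T S f) + 1) *
          t ^ (∑ i ∈ T \ topLayer T (addTop T S f), a i) *
        (1 - t ^ (∑ i ∈ topLayer T (addTop T S f), a i)) =
      (∏ i ∈ T \ P, -t ^ a i) * (∏ i ∈ P \ S, -t ^ a i) -
        (∏ i ∈ T \ P, -t ^ a i) * ((∏ i ∈ S, t ^ a i) * (∏ i ∈ P \ S, -t ^ a i)) := by
    intro S hS
    rw [Finset.mem_erase, Finset.mem_powerset, ← Finset.nonempty_iff_ne_empty] at hS
    have hST := hS.2.trans htT
    simp only [sup_addTop hST hS.1, topLayer_addTop hST hS.1]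
    rw [← Finset.sum_mul, ← Finset.sum_mul]
    -- For a fixed highest level `S` only the sign depends on the levels below, and it is summed by
    -- `sum_layerings_neg_one_pow`. The two extra factors `-1` cancel.
    have h2 : ∑ f ∈ layerings g (T \ S), (-1 : R) ^ ((T \ S).sup f + 1 + 1) =
        (-1) ^ (T \ S).card := by
      rw [← sum_layerings_neg_one_pow g]
      simp [pow_succ]
    have h3 : (∏ i ∈ T \ P, -t ^ a i) * (∏ i ∈ P \ S, -t ^ a i) = ∏ i ∈ T \ S, -t ^ a i := by
      rw [← Finset.prod_union]
      · congr 1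
        ext i
        have h4 : i ∈ S → i ∈ P := fun h => hS.2 h
        have h5 : i ∈ P → i ∈ T := fun h => htT h
        simp only [Finset.mem_union, Finset.mem_sdiff]
        tauto
      · rw [Finset.disjoint_left]
        intro i hi hi'
        simp only [Finset.mem_sdiff] at hi hi'
        tauto
    have h4 : ∏ i ∈ T \ S, -t ^ a i = (-1) ^ (T \ S).card * t ^ (∑ i ∈ T \ S, a i) := by
      rw [Finset.prod_neg, Finset.prod_pow_eq_pow_sum]
    rw [h2, mul_left_comm, h3, h4, Finset.prod_pow_eq_pow_sum]
    ring
  -- The two terms of `h1` agree at the empty set, so it may be restored for free. Over all subsets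
  -- the first term expands the product of `1 - t ^ a i`, the second the product of `t ^ a i - t ^ a
  -- i`, which is zero.
  rw [Finset.sum_congr rfl h1, Finset.sum_sub_distrib, ← Finset.mul_sum, ← Finset.mul_sum,
    Finset.sum_erase_eq_sub (by simp), Finset.sum_erase_eq_sub (by simp)]
  have h2 := Finset.prod_add (fun _ => (1 : R)) (fun i => -t ^ a i) P
  have h3 := Finset.prod_add (fun i => t ^ a i) (fun i => -t ^ a i) P
  simp only [Finset.prod_const_one, one_mul] at h2
  simp only [add_neg_cancel] at h3
  rw [← h2, ← h3, Finset.prod_const, zero_pow (tops_nonempty g hT).card_pos.ne',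
    ← Finset.prod_sdiff htT]
  have h5 : ∏ i ∈ T \ P, (if i ∈ P then 1 - t ^ a i else -t ^ a i) = ∏ i ∈ T \ P, -t ^ a i :=
    Finset.prod_congr rfl fun i hi => if_neg (Finset.mem_sdiff.1 hi).2
  have h6 : ∏ i ∈ P, (if i ∈ P then 1 - t ^ a i else -t ^ a i) = ∏ i ∈ P, (1 + -t ^ a i) :=
    Finset.prod_congr rfl fun i hi => by rw [if_pos hi, sub_eq_add_neg]
  rw [h5, h6]
  simp
  ring

/-! ### Products over levels and products over fibres -/

/-- The product over the levels `1, …, m` of a layering. -/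
noncomputable def layerProd {F : Type*} [Field F] (q t : F) (a : ℕ → ℕ) (T : Finset ℕ)
    (f : ℕ → ℕ) (m : ℕ) : F :=
  ∏ k ∈ Finset.Icc 1 m,
    (q ^ (∑ i ∈ T.filter (f · ≤ k), a i) - t ^ (∑ i ∈ T.filter (f · = k), a i)) /
      (1 - q ^ (∑ i ∈ T.filter (f · ≤ k), a i))

theorem layerProd_addTop_sup {F : Type*} [Field F] (q t : F) (a : ℕ → ℕ) (T S : Finset ℕ)
    (f : ℕ → ℕ) : layerProd q t a T (addTop T S f) ((T \ S).sup f) =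
      layerProd q t a (T \ S) f ((T \ S).sup f) := by
  refine Finset.prod_congr rfl fun k hk => ?_
  rw [Finset.mem_Icc] at hk
  have h1 : T.filter (addTop T S f · ≤ k) = (T \ S).filter (f · ≤ k) := by
    ext i
    by_cases h : i ∈ S
    · simp [h, addTop_of_mem h]
      omega
    · simp [h, addTop_of_notMem h]
  have h2 : T.filter (addTop T S f · = k) = (T \ S).filter (f · = k) := by
    ext i
    by_cases h : i ∈ S
    · simp [h, addTop_of_mem h]
      omega
    · simp [h, addTop_of_notMem h]
  rw [h1, h2]

/-- All of `T` lies at or below the new level and exactly `S` lies on it, so the added factor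
depends on `T` and `S` but not on `f`. -/
theorem layerProd_addTop {F : Type*} [Field F] (q t : F) (a : ℕ → ℕ) {T S : Finset ℕ}
    (hS : S ⊆ T) (hne : S.Nonempty) (f : ℕ → ℕ) :
    layerProd q t a T (addTop T S f) (T.sup (addTop T S f)) =
      layerProd q t a (T \ S) f ((T \ S).sup f) *
        ((q ^ (∑ i ∈ T, a i) - t ^ (∑ i ∈ S, a i)) / (1 - q ^ (∑ i ∈ T, a i))) := by
  have hmem : ∀ i ∈ T, i ∉ S → f i ≤ (T \ S).sup f := fun i hi h =>
    Finset.le_sup (Finset.mem_sdiff.2 ⟨hi, h⟩)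
  rw [sup_addTop hS hne, layerProd, Finset.prod_Icc_succ_top (by omega), ← layerProd,
    layerProd_addTop_sup]
  congr 1
  have h1 : T.filter (addTop T S f · ≤ (T \ S).sup f + 1) = T := by
    refine Finset.filter_true_of_mem fun i hi => ?_
    by_cases h : i ∈ S
    · rw [addTop_of_mem h]
    · rw [addTop_of_notMem h]
      exact (hmem i hi h).trans (Nat.le_succ _)
  have h2 : T.filter (addTop T S f · = (T \ S).sup f + 1) = S := by
    rw [← sup_addTop (f := f) hS hne]
    exact topLayer_addTop hS hne
  rw [h1, h2]

/-- The sum of the `a j` over the elements `j ≤ i` of `T` in the same fibre of `g` as `i`. -/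
def fibreSum (g a : ℕ → ℕ) (T : Finset ℕ) (i : ℕ) : ℕ :=
  ∑ j ∈ T.filter (fun j => j ≤ i ∧ g j = g i), a j

/-- Removing fibre tops does not affect the sums at the remaining elements, because each sum only
involves elements up to its index. -/
theorem fibreSum_sdiff {g : ℕ → ℕ} (a : ℕ → ℕ) {T S : Finset ℕ} (hS : S ⊆ tops g T) {i : ℕ}
    (hi : i ∈ T \ S) : fibreSum g a (T \ S) i = fibreSum g a T i := by
  rw [Finset.mem_sdiff] at hi
  unfold fibreSum
  congr 1
  ext j
  simp only [Finset.mem_filter, Finset.mem_sdiff]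
  refine ⟨fun h => ⟨h.1.1, h.2⟩, fun h => ⟨⟨h.1, fun hj => ?_⟩, h.2⟩⟩
  rcases h.2.1.eq_or_lt with rfl | hlt
  · exact hi.2 hj
  · exact (Finset.mem_filter.1 (hS hj)).2 i hi.1 hlt h.2.2

/-- At its top, a fibre sum runs over the whole fibre, and the fibres partition `T`. -/
theorem sum_fibreSum_tops (g a : ℕ → ℕ) (T : Finset ℕ) :
    ∑ i ∈ tops g T, fibreSum g a T i = ∑ i ∈ T, a i := by
  unfold fibreSum
  rw [← Finset.sum_biUnion]
  · congr 1
    ext j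
    simp only [Finset.mem_biUnion, Finset.mem_filter]
    refine ⟨fun ⟨_, _, h⟩ => h.1, fun hj => ?_⟩
    have hne : (T.filter fun i => g j = g i).Nonempty := ⟨j, by simp [hj]⟩
    have hm := Finset.max'_mem _ hne
    set m := Finset.max' _ hne with hmdef
    rw [Finset.mem_filter] at hm
    refine ⟨m, Finset.mem_filter.2 ⟨hm.1, fun l hl hml hg => ?_⟩, hj,
      Finset.le_max' _ _ (by simp [hj]), hm.2⟩
    have hl' : l ∈ T.filter fun i => g j = g i := Finset.mem_filter.2 ⟨hl, hm.2.trans hg⟩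
    exact absurd (Finset.le_max' _ l hl') (not_le.2 hml)
  · intro i hi j hj hij
    simp only [Finset.mem_coe, tops, Finset.mem_filter] at hi hj
    rw [Function.onFun, Finset.disjoint_left]
    intro l hl hl'
    simp only [Finset.mem_filter] at hl hl'
    have hg : g i = g j := hl.2.2.symm.trans hl'.2.2
    rcases lt_or_gt_of_ne hij with h | h
    · exact hi.2 j hj.1 h hg
    · exact hj.2 i hi.1 h hg.symm

/-- The sum over layerings of the products over the levels is the product over the fibres. -/
theorem sum_layerProd {F : Type*} [Field F] (q t : F) (hq : ∀ n, 0 < n → 1 - q ^ n ≠ 0)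
    (a : ℕ → ℕ) (g : ℕ → ℕ) (T : Finset ℕ) (ha : ∀ i ∈ T, 0 < a i) :
    ∑ f ∈ layerings g T, layerProd q t a T f (T.sup f) =
      ∏ i ∈ T, (q ^ fibreSum g a T i - t ^ a i) / (1 - q ^ fibreSum g a T i) := by
  induction T using Finset.strongInduction with
  | H T ih =>
    rcases T.eq_empty_or_nonempty with rfl | hT
    · simp [layerings_empty, layerProd]
    have htT := tops_subset g T
    rw [sum_layerings g hT]
    set P := tops g T with hP
    set s := fibreSum g a T with hs
    have hs0 : ∀ i ∈ T, 1 - q ^ s i ≠ 0 := fun i hi => hq _ <| by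
      refine (ha i hi).trans_le ?_
      exact Finset.single_le_sum (f := a) (fun _ _ => Nat.zero_le _) (by simp [hi])
    have hQ0 : 1 - q ^ (∑ i ∈ T, a i) ≠ 0 :=
      hq _ (Finset.sum_pos ha hT)
    have hQ : q ^ (∑ i ∈ T, a i) = ∏ i ∈ P, q ^ s i := by
      rw [Finset.prod_pow_eq_pow_sum, sum_fibreSum_tops]
    set Q := q ^ (∑ i ∈ T, a i) with hQdef
    -- `D` gathers what does not depend on the highest level `S`: the factors of the elements that
    -- are not tops, the denominators of the tops, and the denominator of the highest level.
    set D := (∏ i ∈ T \ P, (q ^ s i - t ^ a i) / (1 - q ^ s i)) / (∏ i ∈ P, (1 - q ^ s i)) /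
      (1 - Q) with hD
    have hprod0 : ∏ i ∈ P, (1 - q ^ s i) ≠ 0 := Finset.prod_ne_zero_iff.2 fun i hi =>
      hs0 i (htT hi)
    have h1 : ∀ S ∈ P.powerset.erase ∅,
        ∑ f ∈ layerings g (T \ S), layerProd q t a T (addTop T S f) (T.sup (addTop T S f)) =
        D * (Q * ((∏ i ∈ S, (1 - q ^ s i)) * ∏ i ∈ P \ S, (q ^ s i - t ^ a i))) -
        D * ((∏ i ∈ S, (t ^ a i * (1 - q ^ s i))) * ∏ i ∈ P \ S, (q ^ s i - t ^ a i)) := by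
      intro S hS
      have hss := sdiff_ssubset_of_mem hS
      rw [Finset.mem_erase, Finset.mem_powerset, ← Finset.nonempty_iff_ne_empty] at hS
      have hST := hS.2.trans htT
      simp only [layerProd_addTop q t a hST hS.1]
      rw [← Finset.sum_mul, ih _ hss fun i hi => ha i (Finset.mem_sdiff.1 hi).1]
      have h2 : ∏ i ∈ T \ S, (q ^ fibreSum g a (T \ S) i - t ^ a i) /
            (1 - q ^ fibreSum g a (T \ S) i) =
          (∏ i ∈ T \ P, (q ^ s i - t ^ a i) / (1 - q ^ s i)) *
            ∏ i ∈ P \ S, (q ^ s i - t ^ a i) / (1 - q ^ s i) := by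
        rw [← Finset.prod_union]
        · have h4 : T \ P ∪ P \ S = T \ S := by
            ext i
            have h4 : i ∈ S → i ∈ P := fun h => hS.2 h
            have h5 : i ∈ P → i ∈ T := fun h => htT h
            simp only [Finset.mem_union, Finset.mem_sdiff]
            tauto
          rw [h4]
          exact Finset.prod_congr rfl fun i hi => by rw [fibreSum_sdiff a hS.2 hi]
        · rw [Finset.disjoint_left]
          intro i hi hi'
          simp only [Finset.mem_sdiff] at hi hi'
          tauto
      have h3 := Finset.prod_sdiff (f := fun i => 1 - q ^ s i) hS.2
      have h4 : ∏ i ∈ P \ S, (1 - q ^ s i) ≠ 0 := Finset.prod_ne_zero_iff.2 fun i hi =>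
        hs0 i (htT (Finset.mem_sdiff.1 hi).1)
      have h5 : ∏ i ∈ S, (1 - q ^ s i) ≠ 0 := Finset.prod_ne_zero_iff.2 fun i hi =>
        hs0 i (hST hi)
      rw [h2, Finset.prod_div_distrib (s := P \ S), Finset.prod_mul_distrib (s := S), hD, ← h3,
        Finset.prod_pow_eq_pow_sum, ← hQdef]
      field_simp
    rw [Finset.sum_congr rfl h1, Finset.sum_sub_distrib, ← Finset.mul_sum, ← Finset.mul_sum,
      ← Finset.mul_sum, Finset.sum_erase_eq_sub (by simp), Finset.sum_erase_eq_sub (by simp)]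
    have h2 := Finset.prod_add (fun i => 1 - q ^ s i) (fun i => q ^ s i - t ^ a i) P
    have h3 := Finset.prod_add (fun i => t ^ a i * (1 - q ^ s i)) (fun i => q ^ s i - t ^ a i) P
    -- Both sums over all subsets equal `Q` times the product of the `1 - t ^ a i`, hence cancel.
    -- Only minus the empty-set term is left, and its factor `1 - Q` cancels the denominator in `D`.
    have h4 : ∏ i ∈ P, (t ^ a i * (1 - q ^ s i) + (q ^ s i - t ^ a i)) =
        Q * ∏ i ∈ P, (1 - q ^ s i + (q ^ s i - t ^ a i)) := by
      rw [hQ, ← Finset.prod_mul_distrib]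
      exact Finset.prod_congr rfl fun i _ => by ring
    rw [← h2, ← h3, h4, ← Finset.prod_sdiff htT, Finset.prod_div_distrib (s := P), hD]
    simp only [Finset.prod_empty, Finset.sdiff_empty, one_mul]
    field_simp
    ring

end WordQSym
namespace WordQSym

/-! ### Standard form of the words with a given packed word -/

theorem IsPacked.mem_iff {u : List ℕ} (hu : IsPacked u) {a : ℕ} :
    a ∈ u ↔ 1 ≤ a ∧ a ≤ maxLetter u := by
  obtain ⟨p, hp⟩ := hu
  by_cases h : u = []
  · subst h
    simp [maxLetter]
    omega
  · have h1 := (hp _).1 (maxLetter_mem h)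
    have h2 := le_maxLetter ((hp p).2 ⟨h1.1.trans h1.2, le_rfl⟩)
    rw [hp]
    omega

theorem packList_map_of_isPacked {A : Type*} [LinearOrder A] {u : List ℕ} (hu : IsPacked u)
    (φ : ℕ → A) (hφ : StrictMonoOn φ {a | a ∈ u}) : packList (u.map φ) = u := by
  rw [packList_map φ u hφ, packList_of_isPacked hu]

/-- The substitution is the inverse of `rank z` on the letters of `z`. It turns statements on packed
words into statements on increasing maps. -/
theorem exists_strictMonoOn_of_packList {A : Type*} [LinearOrder A] [Nonempty A] {u : List ℕ}
    {z : List A} (h : packList z = u) :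
    ∃ φ : ℕ → A, StrictMonoOn φ {a | a ∈ u} ∧ z = u.map φ := by
  subst h
  have hm := rank_strictMonoOn z
  set φ := Function.invFunOn (rank z) {a | a ∈ z}
  have hφ : ∀ a ∈ z, φ (rank z a) = a := fun a ha =>
    hm.injOn.leftInvOn_invFunOn ha
  refine ⟨φ, ?_, ?_⟩
  · intro k hk l hl hkl
    obtain ⟨a, ha, rfl⟩ := List.mem_map.1 hk
    obtain ⟨b, hb, rfl⟩ := List.mem_map.1 hl
    rw [hφ a ha, hφ b hb]
    exact (hm.lt_iff_lt ha hb).1 hkl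
  · rw [packList, List.map_map]
    conv_lhs => rw [← List.map_id z]
    exact List.map_congr_left fun a ha => (hφ a ha).symm

theorem pack_eq_iff {A : Type*} [LinearOrder A] {z : List A} {u : PackedWord} :
    pack z = u ↔ packList z = u.1 := Subtype.ext_iff

/-- This form of packedness matches the positivity and no-gap conditions in `IsLayering`. -/
theorem isPacked_iff_exists_of_le {u : List ℕ} :
    IsPacked u ↔ (∀ a ∈ u, 0 < a) ∧ ∀ a ∈ u, ∀ k, 0 < k → k ≤ a → k ∈ u := by
  constructor
  · intro hu
    refine ⟨fun a ha => (hu.mem_iff.1 ha).1, fun a ha k hk hka => ?_⟩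
    rw [hu.mem_iff] at ha ⊢
    omega
  · rintro ⟨h1, h2⟩
    refine ⟨maxLetter u, fun a => ⟨fun ha => ⟨h1 a ha, le_maxLetter ha⟩, fun ha => ?_⟩⟩
    by_cases h : u = []
    · subst h
      simp [maxLetter] at ha
      omega
    · exact h2 _ (maxLetter_mem h) a ha.1 ha.2

theorem length_eq_sum_count {w : List ℕ} {T : Finset ℕ} (h : ∀ a ∈ w, a ∈ T) :
    ∑ i ∈ T, w.count i = w.length := by
  have : w.toFinset ⊆ T := fun a ha => h a (by simpa using ha)
  rw [← List.sum_toFinset_count_eq_length]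
  symm
  refine Finset.sum_subset this fun i _ hi => ?_
  simpa [List.count_eq_zero] using hi

theorem sum_map_eq_sum_count {w : List ℕ} {T : Finset ℕ} (h : ∀ a ∈ w, a ∈ T) (f : ℕ → ℕ) :
    (w.map f).sum = ∑ i ∈ T, w.count i * f i := by
  have : w.toFinset ⊆ T := fun a ha => h a (by simpa using ha)
  rw [Finset.sum_list_map_count]
  simp only [smul_eq_mul]
  refine Finset.sum_subset this fun i _ hi => ?_
  rw [List.count_eq_zero.2 (by simpa using hi), zero_mul]

theorem countP_map_eq_sum {w : List ℕ} {T : Finset ℕ} (h : ∀ a ∈ w, a ∈ T) (f : ℕ → ℕ)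
    (P : ℕ → Prop) [DecidablePred P] :
    (w.map f).countP (fun k => decide (P k)) = ∑ i ∈ T.filter (fun i => P (f i)), w.count i := by
  rw [Finset.sum_filter]
  have h1 := sum_map_eq_sum_count h (fun i => if P (f i) then 1 else 0)
  simp only [mul_ite, mul_one, mul_zero] at h1
  rw [← h1, List.countP_map]
  clear h h1
  induction w with
  | nil => rfl
  | cons b w ih =>
    rw [List.countP_cons, ih, List.map_cons, List.sum_cons]
    simp [add_comm]

theorem maxLetter_map_eq_sup {w : List ℕ} {T : Finset ℕ} (h : ∀ a, a ∈ w ↔ a ∈ T) (f : ℕ → ℕ) :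
    maxLetter (w.map f) = T.sup f := by
  apply le_antisymm
  · by_cases hw : w = []
    · subst hw
      simp [maxLetter]
    · obtain ⟨a, ha, h'⟩ := List.mem_map.1 (maxLetter_mem (w := w.map f) (by simpa using hw))
      rw [← h']
      exact Finset.le_sup ((h a).1 ha)
  · exact Finset.sup_le fun i hi => le_maxLetter (List.mem_map_of_mem ((h i).2 hi))

theorem count_map_eq_sum {w : List ℕ} {T : Finset ℕ} (h : ∀ a ∈ w, a ∈ T) (f : ℕ → ℕ) (k : ℕ) :
    (w.map f).count k = ∑ i ∈ T.filter (fun i => f i = k), w.count i := by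
  rw [← countP_map_eq_sum h f (fun j => j = k), List.count]
  congr 1

/-- The packed words obtained by substituting the levels of the layerings of `T` for the letters of
a word with set of letters `T`. -/
theorem sum_PW_eq_sum_layerings {R : Type*} [AddCommMonoid R] {ω : List ℕ} {T : Finset ℕ}
    (hT : ∀ a, a ∈ ω ↔ a ∈ T) (g : ℕ → ℕ) (P : PackedWord → Prop) [DecidablePred P]
    (hP : ∀ v ∈ PW ω.length, P v ↔ ∃ f : ℕ → ℕ, v.1 = ω.map f ∧
      ∀ i ∈ T, ∀ j ∈ T, i < j → g i = g j → f i < f j) (Ψ : List ℕ → R) :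
    ∑ v ∈ (PW ω.length).filter P, Ψ v.1 = ∑ f ∈ layerings g T, Ψ (ω.map f) := by
  symm
  refine Finset.sum_nbij (fun f => pack (ω.map f)) ?_ ?_ ?_ ?_
  all_goals
    have hpk : ∀ f, IsLayering g T f → IsPacked (ω.map f) := by
      intro f hf
      rw [isPacked_iff_exists_of_le]
      simp only [List.mem_map, hT]
      refine ⟨?_, ?_⟩
      · rintro _ ⟨i, hi, rfl⟩
        exact hf.2.1 i hi
      · rintro _ ⟨i, hi, rfl⟩ k hk hki
        exact hf.2.2.1 i hi k hk hki
    have hval : ∀ f, IsLayering g T f → (pack (ω.map f)).1 = ω.map f := fun f hf =>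
      packList_of_isPacked (hpk f hf)
  · intro f hf
    rw [mem_layerings] at hf
    have hmem : pack (ω.map f) ∈ PW ω.length := by simp [pack]
    exact Finset.mem_filter.2 ⟨hmem, (hP _ hmem).2 ⟨f, hval f hf, hf.2.2.2⟩⟩
  · intro f hf f' hf' h
    simp only [Finset.mem_coe, mem_layerings] at hf hf'
    have h' : ω.map f = ω.map f' := by
      rw [← hval f hf, ← hval f' hf']
      exact congrArg Subtype.val h
    funext i
    by_cases hi : i ∈ T
    · exact List.map_inj_left.1 h' i ((hT i).2 hi)
    · rw [hf.1 i hi, hf'.1 i hi]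
  · intro v hv
    rw [Finset.mem_coe, Finset.mem_filter] at hv
    obtain ⟨f, hf, hmono⟩ := (hP v hv.1).1 hv.2
    -- The values of `f` outside `T` are irrelevant to the word; layerings are normalized to `0`
    -- there, which makes them unique.
    have hf' : ω.map (fun i => if i ∈ T then f i else 0) = v.1 := by
      rw [hf]
      exact List.map_congr_left fun i hi => if_pos ((hT i).1 hi)
    have hvp := isPacked_iff_exists_of_le.1 v.2
    rw [hf] at hvp
    simp only [List.mem_map, hT] at hvp
    refine ⟨fun i => if i ∈ T then f i else 0, ?_, ?_⟩
    · rw [Finset.mem_coe, mem_layerings]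
      refine ⟨fun i hi => if_neg hi, fun i hi => ?_, fun i hi k hk hki => ?_,
        fun i hi j hj hij hg => ?_⟩
      · simpa [hi] using hvp.1 _ ⟨i, hi, rfl⟩
      · simp only [hi, if_true] at hki
        obtain ⟨j, hj, h⟩ := hvp.2 _ ⟨i, hi, rfl⟩ k hk hki
        exact ⟨j, hj, by simp [hj, h]⟩
      · simpa [hi, hj] using hmono i hi j hj hij hg
    · show pack _ = v
      rw [hf', pack_coe]
  · intro f hf
    rw [hval f (mem_layerings.1 hf)]

end WordQSym
namespace WordQSym

/-! ### The coefficients of `σ₁((1-t)A)` -/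

theorem ev_pos (v : PackedWord) : ∀ a ∈ ev v, 0 < a := by
  intro a ha
  obtain ⟨k, hk, rfl⟩ := List.mem_map.1 ha
  rw [List.mem_range] at hk
  exact List.count_pos_iff.2 (v.2.mem_iff.2 ⟨by omega, hk⟩)

theorem sum_ev (v : PackedWord) : (ev v).sum = v.1.length := by
  rw [← length_eq_sum_count (w := v.1) (T := (Finset.range (maxLetter v.1)).image (· + 1)),
    Finset.sum_image (by simp), ev, ← List.sum_toFinset _ (List.nodup_range)]
  · congr 1
    ext; simp
  · intro a ha
    have := v.2.mem_iff.1 ha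
    exact Finset.mem_image.2 ⟨a - 1, by simp; omega, by omega⟩

variable {R : Type*} [CommRing R]

theorem symEmbed_apply (x : NSym R) (v : PackedWord) (I : List ℕ+)
    (hI : I.map PNat.val = ev v) :
    symEmbed R x v = x.coeff (FreeMonoid.ofList I) := by
  classical
  have key : ∀ (J : FreeMonoid ℕ+) (c : R),
      (c • ∑ u ∈ (PW ((J.toList.map PNat.val).sum)).filter
        (fun u => ev u = J.toList.map PNat.val), N R u) v =
      if J = FreeMonoid.ofList I then c else 0 := by
    intro J c
    rw [Finsupp.smul_apply, Finsupp.finsetSum_apply]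
    simp only [N, Finsupp.single_apply, Finset.sum_ite_eq', Finset.mem_filter, mem_PW, smul_eq_mul,
      mul_ite, mul_one, mul_zero]
    refine if_congr ?_ rfl rfl
    rw [← hI]
    constructor
    · rintro ⟨_, h⟩
      have := List.map_injective_iff.2 PNat.coe_injective h
      rw [this]
      rfl
    · rintro rfl
      refine ⟨?_, rfl⟩
      rw [← sum_ev, ← hI]
      rfl
  rw [symEmbed, Finsupp.sum, Finsupp.finsetSum_apply]
  simp only [key]
  simpa using fun h => h.symm

theorem completeS_pnat (a : ℕ+) :
    completeS R a = MonoidAlgebra.of R (FreeMonoid ℕ+) (FreeMonoid.of a) := dif_pos a.2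

theorem exists_pnat_list {L : List ℕ} (hL : ∀ a ∈ L, 0 < a) :
    ∃ l : List ℕ+, l.map PNat.val = L := by
  induction L with
  | nil => exact ⟨[], rfl⟩
  | cons a L ih =>
    obtain ⟨l, rfl⟩ := ih fun b hb => hL b (List.mem_cons_of_mem _ hb)
    exact ⟨⟨a, hL a List.mem_cons_self⟩ :: l, rfl⟩

theorem prod_completeS (l : List ℕ+) :
    ((l.map PNat.val).map (completeS R)).prod =
      MonoidAlgebra.of R (FreeMonoid ℕ+) (FreeMonoid.ofList l) := by
  induction l with
  | nil => simp; rfl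
  | cons a l ih =>
    rw [List.map_cons, List.map_cons, List.prod_cons, ih, completeS_pnat, ← map_mul]
    rfl

/-- Distinct compositions give distinct monomials, so at most one composition of `k` contributes. -/
theorem elementaryL_coeff (k : ℕ) (I : List ℕ+) :
    (elementaryL R k).coeff (FreeMonoid.ofList I) =
      if (I.map PNat.val).sum = k then (-1) ^ (k - I.length) else 0 := by
  have key : ∀ J : Composition k, ((J.blocks.map (completeS R)).prod).coeff (FreeMonoid.ofList I) =
      if J.blocks = I.map PNat.val then 1 else 0 := by
    classical
    intro J
    obtain ⟨l, hl⟩ := exists_pnat_list fun a (ha : a ∈ J.blocks) => J.blocks_pos ha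
    rw [← hl, prod_completeS, MonoidAlgebra.of_apply, MonoidAlgebra.coeff_single,
      Finsupp.single_apply]
    refine if_congr ?_ rfl rfl
    rw [(List.map_injective_iff.2 PNat.coe_injective).eq_iff, Equiv.apply_eq_iff_eq]
  rw [elementaryL, MonoidAlgebra.coeff_sum, Finsupp.finsetSum_apply]
  simp only [MonoidAlgebra.coeff_smul_apply, key]
  by_cases h : (I.map PNat.val).sum = k
  · rw [if_pos h, Finset.sum_eq_single (⟨I.map PNat.val, by
      intro i hi
      obtain ⟨a, _, rfl⟩ := List.mem_map.1 hi
      exact a.2, h⟩ : Composition k)]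
    · simp [Composition.length]
    · intro J _ hJ
      rw [if_neg, smul_zero]
      exact fun h' => hJ (Composition.ext h')
    · simp
  · rw [if_neg h]
    refine Finset.sum_eq_zero fun J _ => ?_
    rw [if_neg, smul_zero]
    intro h'
    exact h (h' ▸ J.blocks_sum)

theorem length_le_sum_map_val (I : List ℕ+) : I.length ≤ (I.map PNat.val).sum := by
  induction I with
  | nil => simp
  | cons a I ih =>
    have := a.2
    simp only [List.length_cons, List.map_cons, List.sum_cons]
    simp only [PNat.val] at *
    omega

theorem neg_pow_mul_neg_one_pow_sub (t : R) {k l : ℕ} (h : l ≤ k) :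
    (-t) ^ k * (-1) ^ (k - l) = (-1) ^ l * t ^ k := by
  obtain ⟨m, rfl⟩ := Nat.exists_eq_add_of_le h
  have : (-1 : R) ^ m * (-1) ^ m = 1 := by rw [← mul_pow]; simp
  rw [Nat.add_sub_cancel_left, neg_pow, pow_add (-1 : R)]
  linear_combination (-1) ^ l * t ^ (l + m) * this

theorem sigmaOneSub_coeff (t : R) (J : List ℕ+) (j : ℕ+) (n : ℕ)
    (hn : (J.map PNat.val).sum + j = n) :
    (sigmaOneSub t n).coeff (FreeMonoid.ofList (J ++ [j])) =
      (-1) ^ J.length * t ^ (n - j) * (1 - t ^ (j : ℕ)) := by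
  have hj : 0 < (j : ℕ) := j.2
  have hsum : ((J ++ [j]).map PNat.val).sum = n := by
    rw [← hn]
    simp
  have hlen := length_le_sum_map_val (J ++ [j])
  have hlenJ := length_le_sum_map_val J
  have hnj : n - j = (J.map PNat.val).sum := by omega
  -- Every monomial of the product ends with the letter `n - k`, which must be `j`. So two values of
  -- `k` matter in all: `n - j`, and `n`, where the right factor is `S_0 = 1`.
  have hmul : ∀ k < n, (elementaryL R k * completeS R (n - k)).coeff
      (FreeMonoid.ofList (J ++ [j])) = if k = n - j then (-1) ^ (k - J.length) else 0 := by
    intro k hk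
    obtain ⟨c, hc⟩ : ∃ c : ℕ+, (c : ℕ) = n - k := ⟨⟨n - k, by omega⟩, rfl⟩
    rw [← hc, completeS_pnat, MonoidAlgebra.of_apply]
    by_cases h : k = n - j
    · obtain rfl : c = j := PNat.coe_injective (by omega)
      rw [if_pos h, MonoidAlgebra.coeff_mul_single_eq_coeff_mul (FreeMonoid.ofList J),
        elementaryL_coeff, if_pos (by omega), mul_one]
      intro m _
      rw [FreeMonoid.ofList_append]
      exact mul_left_inj _
    · rw [if_neg h, MonoidAlgebra.coeff_mul_single_of_forall_mul_ne]
      intro d hd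
      have h1 := congrArg FreeMonoid.toList hd
      rw [FreeMonoid.toList_mul, FreeMonoid.toList_ofList, FreeMonoid.toList_of] at h1
      have h2 := congrArg PNat.val (List.singleton_inj.1 (List.append_inj' h1 rfl).2)
      change (c : ℕ) = j at h2
      omega
  rw [sigmaOneSub, MonoidAlgebra.coeff_sum, Finsupp.finsetSum_apply, Finset.sum_range_succ]
  simp only [MonoidAlgebra.coeff_smul_apply, smul_eq_mul]
  have h1 : ∑ k ∈ Finset.range n, (-t) ^ k * (elementaryL R k * completeS R (n - k)).coeff
      (FreeMonoid.ofList (J ++ [j])) = (-t) ^ (n - j : ℕ) * (-1) ^ ((n - j : ℕ) - J.length) := by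
    rw [Finset.sum_congr rfl fun k hk => by rw [hmul k (Finset.mem_range.1 hk)],
      Finset.sum_eq_single (n - j : ℕ)]
    · simp
    · intro k _ hk
      simp [hk]
    · intro h
      exact absurd (Finset.mem_range.2 (Nat.sub_lt (hn ▸ Nat.add_pos_right _ hj) hj)) h
  have h0 : completeS R 0 = 1 := by simp [completeS]
  rw [h1, Nat.sub_self, h0, mul_one, elementaryL_coeff, if_pos hsum,
    neg_pow_mul_neg_one_pow_sub t (hlenJ.trans_eq hnj.symm),
    neg_pow_mul_neg_one_pow_sub t (hlen.trans_eq hsum),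
    List.length_append, List.length_singleton]
  have htn : t ^ n = t ^ (n - j : ℕ) * t ^ (j : ℕ) := by
    rw [← pow_add, Nat.sub_add_cancel (hn ▸ Nat.le_add_left _ _)]
  rw [htn]
  ring

/-- The coefficient of `N_v` in `σ₁((1-t)A)`. -/
theorem symEmbed_sigmaOneSub (t : R) {n : ℕ} (hn : 0 < n) {v : PackedWord} (hv : v ∈ PW n) :
    symEmbed R (sigmaOneSub t n) v =
      (-1) ^ (maxLetter v.1 + 1) * t ^ (n - Nmax v.1) * (1 - t ^ Nmax v.1) := by
  rw [mem_PW] at hv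
  have hne : v.1 ≠ [] := by
    intro h
    rw [h] at hv
    simp at hv
    omega
  have hmax := (v.2.mem_iff.1 (maxLetter_mem hne)).1
  obtain ⟨r, hr⟩ := Nat.exists_eq_add_of_le' hmax
  obtain ⟨I, hI⟩ := exists_pnat_list (ev_pos v)
  -- The last part of the evaluation is the multiplicity of the maximal letter, so
  -- `sigmaOneSub_coeff` applies with `j = Nmax v.1` and with `r` earlier parts.
  have hev : ev v = ((List.range r).map fun k => v.1.count (k + 1)) ++ [Nmax v.1] := by
    rw [ev, Nmax, hr, List.range_succ, List.map_append, List.map_singleton]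
  rcases List.eq_nil_or_concat I with rfl | ⟨J, j, rfl⟩
  · rw [hev] at hI
    simp at hI
  · rw [List.concat_eq_append] at hI
    have hs := sum_ev v
    rw [← hI] at hs
    rw [symEmbed_apply _ v _ hI, sigmaOneSub_coeff t J j n (by rw [← hv, ← hs]; simp)]
    rw [hev, List.map_append] at hI
    obtain ⟨h1, h2⟩ := List.append_inj' hI rfl
    have h3 : (j : ℕ) = Nmax v.1 := List.singleton_inj.1 h2
    have h4 : J.length = r := by simpa using congrArg List.length h1
    rw [h3, h4, hr, pow_add _ _ 2]
    simp

theorem eta_N_apply (t : R) {n : ℕ} {u : PackedWord} (hu : u ∈ PW n) (w : PackedWord) :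
    eta t (N R u) w =
      ∑ v ∈ (PW n).filter (fun v => packPair u v = w), symEmbed R (sigmaOneSub t n) v := by
  rw [mem_PW] at hu
  rw [eta, N, Finsupp.linearCombination_single, one_smul, hu]
  set g := symEmbed R (sigmaOneSub t n)
  rw [internalMul, N, Finsupp.sum_single_index (by simp), Finsupp.sum, Finsupp.finsetSum_apply,
    Finset.sum_filter]
  have h1 : ∀ v ∈ g.support, (if u.1.length = v.1.length then ((1 : R) * g v) • N R (packPair u v)
      else 0) w = if v ∈ PW n then (if packPair u v = w then g v else 0) else 0 := by
    intro v _
    by_cases h : u.1.length = v.1.length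
    · rw [if_pos h, if_pos (by rw [mem_PW, ← h, hu])]
      simp [N, Finsupp.single_apply]
    · rw [if_neg h, if_neg (by rw [mem_PW, ← hu]; exact Ne.symm h)]
      rfl
  rw [Finset.sum_congr rfl h1, Finset.sum_ite_mem]
  refine Finset.sum_subset Finset.inter_subset_right fun v hv hv' => ?_
  have : v ∉ g.support := fun h => hv' (Finset.mem_inter.2 ⟨h, hv⟩)
  simp [Finsupp.notMem_support_iff.1 this]

end WordQSym
namespace WordQSym

/-! ### Sums over antitone sequences -/

/-- The antitone sequences `g 1 ≥ … ≥ g p` with `∑ a i * g i = d`, extended by `0`. -/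
def IsAntiSeq (a : ℕ → ℕ) (p d : ℕ) (g : ℕ → ℕ) : Prop :=
  (∀ i ∉ Finset.Icc 1 p, g i = 0) ∧
    (∀ i ∈ Finset.Icc 1 p, ∀ j ∈ Finset.Icc 1 p, i ≤ j → g j ≤ g i) ∧
    ∑ i ∈ Finset.Icc 1 p, a i * g i = d

/-- Positive multiplicities bound every term of the sequence by `d`. -/
theorem finite_isAntiSeq {a : ℕ → ℕ} {p : ℕ} (ha : ∀ i ∈ Finset.Icc 1 p, 0 < a i) (d : ℕ) :
    {g | IsAntiSeq a p d g}.Finite :=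
  (finite_bounded_support (Finset.Icc 1 p) d).subset fun g hg => ⟨hg.1, fun i hi =>
    (Nat.le_mul_of_pos_left _ (ha i hi)).trans <| hg.2.2 ▸
      Finset.single_le_sum (f := fun i => a i * g i) (fun _ _ => Nat.zero_le _) hi⟩

open Classical in
/-- The finite set of antitone sequences `g 1 ≥ … ≥ g p` with `∑ a i * g i = d` (it is empty by
convention if it would not be finite). -/
noncomputable def antiSeqs (a : ℕ → ℕ) (p d : ℕ) : Finset (ℕ → ℕ) :=
  if h : ∀ i ∈ Finset.Icc 1 p, 0 < a i then (finite_isAntiSeq h d).toFinset else ∅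

theorem mem_antiSeqs {a : ℕ → ℕ} {p d : ℕ} (ha : ∀ i ∈ Finset.Icc 1 p, 0 < a i) {g : ℕ → ℕ} :
    g ∈ antiSeqs a p d ↔ IsAntiSeq a p d g := by
  rw [antiSeqs, dif_pos ha]
  simp

/-- The sequence obtained by adding `1` to the terms `g 1, …, g p`. -/
def shiftSeq (p : ℕ) (g : ℕ → ℕ) : ℕ → ℕ := fun i => if i ∈ Finset.Icc 1 p then g i + 1 else g i

theorem sum_mul_shiftSeq (a : ℕ → ℕ) (p : ℕ) (g : ℕ → ℕ) :
    ∑ i ∈ Finset.Icc 1 p, a i * shiftSeq p g i =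
      ∑ i ∈ Finset.Icc 1 p, a i * g i + ∑ i ∈ Finset.Icc 1 p, a i := by
  rw [← Finset.sum_add_distrib]
  refine Finset.sum_congr rfl fun i hi => ?_
  rw [shiftSeq, if_pos hi]
  ring

theorem isAntiSeq_shiftSeq {a : ℕ → ℕ} {p d : ℕ} {g : ℕ → ℕ} (hg : IsAntiSeq a p d g) :
    IsAntiSeq a p (d + ∑ i ∈ Finset.Icc 1 p, a i) (shiftSeq p g) := by
  refine ⟨fun i hi => ?_, fun i hi j hj hij => ?_, ?_⟩
  · rw [shiftSeq, if_neg hi, hg.1 i hi]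
  · rw [shiftSeq, shiftSeq, if_pos hi, if_pos hj]
    exact Nat.succ_le_succ (hg.2.1 i hi j hj hij)
  · rw [sum_mul_shiftSeq, hg.2.2]

/-- An antitone sequence ends with `0`, or is obtained from another one by adding `1`. -/
theorem sum_antiSeqs_succ {R : Type*} [AddCommMonoid R] {a : ℕ → ℕ} {p : ℕ}
    (ha : ∀ i ∈ Finset.Icc 1 (p + 1), 0 < a i) (d : ℕ) (Φ : (ℕ → ℕ) → R) :
    ∑ g ∈ antiSeqs a (p + 1) d, Φ g = ∑ g ∈ antiSeqs a p d, Φ g +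
      if ∑ i ∈ Finset.Icc 1 (p + 1), a i ≤ d then
        ∑ g ∈ antiSeqs a (p + 1) (d - ∑ i ∈ Finset.Icc 1 (p + 1), a i), Φ (shiftSeq (p + 1) g)
      else 0 := by
  have hsub : Finset.Icc 1 p ⊆ Finset.Icc 1 (p + 1) := Finset.Icc_subset_Icc_right (by omega)
  have hlast : p + 1 ∈ Finset.Icc 1 (p + 1) := by simp
  rw [← Finset.sum_filter_add_sum_filter_not _ (fun g => g (p + 1) = 0)]
  congr 1
  · refine Finset.sum_congr ?_ fun _ _ => rfl
    ext g
    rw [Finset.mem_filter, mem_antiSeqs ha, mem_antiSeqs fun i hi => ha i (hsub hi)]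
    constructor
    · rintro ⟨hg, h0⟩
      refine ⟨fun i hi => ?_, fun i hi j hj hij => hg.2.1 i (hsub hi) j (hsub hj) hij, ?_⟩
      · by_cases h : i = p + 1
        · rw [h, h0]
        · refine hg.1 i fun hi' => hi ?_
          rw [Finset.mem_Icc] at hi' ⊢
          omega
      · have := hg.2.2
        rwa [Finset.sum_Icc_succ_top (by omega), h0, mul_zero, add_zero] at this
    · intro hg
      have h0 : g (p + 1) = 0 := hg.1 _ (by simp)
      refine ⟨⟨fun i hi => hg.1 i fun h => hi (hsub h), fun i hi j hj hij => ?_, ?_⟩, h0⟩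
      · by_cases h : j = p + 1
        · rw [h, h0]
          exact Nat.zero_le _
        · rw [Finset.mem_Icc] at hi hj
          exact hg.2.1 i (Finset.mem_Icc.2 (by omega)) j (Finset.mem_Icc.2 (by omega)) hij
      · rw [Finset.sum_Icc_succ_top (by omega), h0, mul_zero, add_zero, hg.2.2]
  · split_ifs with hd
    · symm
      refine Finset.sum_nbij' (shiftSeq (p + 1)) (fun g i => g i - 1) ?_ ?_ ?_ ?_ ?_
      · intro g hg
        rw [mem_antiSeqs ha] at hg
        rw [Finset.mem_filter, mem_antiSeqs ha]
        refine ⟨?_, ?_⟩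
        · have := isAntiSeq_shiftSeq hg
          rwa [Nat.sub_add_cancel hd] at this
        · rw [shiftSeq, if_pos hlast]
          omega
      · intro g hg
        rw [Finset.mem_filter, mem_antiSeqs ha] at hg
        obtain ⟨hg, h0⟩ := hg
        rw [mem_antiSeqs ha]
        refine ⟨fun i hi => by simp [hg.1 i hi], fun i hi j hj hij =>
          Nat.sub_le_sub_right (hg.2.1 i hi j hj hij) 1, ?_⟩
        have h1 := sum_mul_shiftSeq a (p + 1) (fun i => g i - 1)
        have h2 : ∑ i ∈ Finset.Icc 1 (p + 1), a i * shiftSeq (p + 1) (fun i => g i - 1) i = d := by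
          rw [← hg.2.2]
          refine Finset.sum_congr rfl fun i hi => ?_
          have := hg.2.1 i hi (p + 1) hlast (Finset.mem_Icc.1 hi).2
          rw [shiftSeq, if_pos hi, Nat.sub_add_cancel (by omega)]
        rw [h2] at h1
        exact Nat.eq_sub_of_add_eq h1.symm
      · intro g hg
        rw [mem_antiSeqs ha] at hg
        funext i
        by_cases hi : i ∈ Finset.Icc 1 (p + 1)
        · simp only [shiftSeq, if_pos hi, Nat.add_sub_cancel]
        · simp only [shiftSeq, if_neg hi, hg.1 i hi]
      · intro g hg
        rw [Finset.mem_filter, mem_antiSeqs ha] at hg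
        obtain ⟨hg, h0⟩ := hg
        funext i
        by_cases hi : i ∈ Finset.Icc 1 (p + 1)
        · have := hg.2.1 i hi (p + 1) hlast (Finset.mem_Icc.1 hi).2
          rw [shiftSeq, if_pos hi, Nat.sub_add_cancel (by omega)]
        · simp only [shiftSeq, if_neg hi, hg.1 i hi]
      · intro g _
        rfl
    · refine Finset.sum_eq_zero fun g hg => absurd ?_ hd
      rw [Finset.mem_filter, mem_antiSeqs ha] at hg
      obtain ⟨hg, h0⟩ := hg
      rw [← hg.2.2]
      refine Finset.sum_le_sum fun i hi => Nat.le_mul_of_pos_right _ ?_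
      have := hg.2.1 i hi (p + 1) hlast (Finset.mem_Icc.1 hi).2
      omega

/-! ### Generating series of the descent weights -/

section Series

variable {R : Type*} [CommRing R] (t : R) (a : ℕ → ℕ)

/-- The weight of a sequence: a factor `1 - t ^ a i` for each strict descent `g i > g (i + 1)` and
`-t ^ a i` for each equality. -/
def descentWeight (p : ℕ) (g : ℕ → ℕ) : R :=
  ∏ i ∈ Finset.Icc 1 p, if g (i + 1) < g i then 1 - t ^ a i else -t ^ a i

/-- The generating series of the weights of the antitone sequences `g 1 ≥ … ≥ g m`, where the
positions up to `p` contribute to the weights. -/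
noncomputable def descentSeries (m p : ℕ) : R⟦X⟧ :=
  PowerSeries.mk fun d => ∑ g ∈ antiSeqs a m d, descentWeight t a p g

theorem descentWeight_succ (p : ℕ) (g : ℕ → ℕ) : descentWeight t a (p + 1) g =
    descentWeight t a p g * if g (p + 2) < g (p + 1) then 1 - t ^ a (p + 1) else -t ^ a (p + 1) :=
  Finset.prod_Icc_succ_top (by omega) _

/-- The weight up to `p` only compares terms with indices at most `p + 1`, and all of these are
shifted together. -/
theorem descentWeight_shiftSeq (p : ℕ) (g : ℕ → ℕ) :
    descentWeight t a p (shiftSeq (p + 1) g) = descentWeight t a p g := by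
  refine Finset.prod_congr rfl fun i hi => ?_
  rw [Finset.mem_Icc] at hi
  have h1 : i ∈ Finset.Icc 1 (p + 1) := Finset.mem_Icc.2 (by omega)
  have h2 : i + 1 ∈ Finset.Icc 1 (p + 1) := Finset.mem_Icc.2 (by omega)
  simp only [shiftSeq, if_pos h1, if_pos h2, Nat.add_lt_add_iff_right]

variable {a}

/-- Subtracting the shifted sequences leaves those with `g (p + 1) = 0`, which are the sequences of
length `p`. -/
theorem descentSeries_succ_left {p : ℕ} (ha : ∀ i ∈ Finset.Icc 1 (p + 1), 0 < a i) :
    (1 - PowerSeries.X ^ (∑ i ∈ Finset.Icc 1 (p + 1), a i)) * descentSeries t a (p + 1) p =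
      descentSeries t a p p := by
  rw [sub_mul, one_mul, sub_eq_iff_eq_add]
  ext d
  rw [map_add, PowerSeries.coeff_X_pow_mul', descentSeries, descentSeries]
  simp only [PowerSeries.coeff_mk]
  rw [sum_antiSeqs_succ ha]
  simp only [descentWeight_shiftSeq]

/-- Since `g (p + 2) = 0`, the new factor only tests whether `g (p + 1)` is positive: it is `-t ^ a
(p + 1)` on sequences ending with `0`, and `1 - t ^ a (p + 1)` on shifted ones. -/
theorem descentSeries_succ {p : ℕ} (ha : ∀ i ∈ Finset.Icc 1 (p + 1), 0 < a i) :
    descentSeries t a (p + 1) (p + 1) =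
      PowerSeries.C (-t ^ a (p + 1)) * descentSeries t a p p +
        PowerSeries.C (1 - t ^ a (p + 1)) * (PowerSeries.X ^ (∑ i ∈ Finset.Icc 1 (p + 1), a i) *
          descentSeries t a (p + 1) p) := by
  have hsub : Finset.Icc 1 p ⊆ Finset.Icc 1 (p + 1) := Finset.Icc_subset_Icc_right (by omega)
  ext d
  rw [map_add, PowerSeries.coeff_C_mul, PowerSeries.coeff_C_mul, PowerSeries.coeff_X_pow_mul',
    descentSeries, descentSeries, descentSeries]
  simp only [PowerSeries.coeff_mk]
  rw [sum_antiSeqs_succ ha, Finset.mul_sum]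
  congr 1
  · refine Finset.sum_congr rfl fun g hg => ?_
    rw [mem_antiSeqs fun i hi => ha i (hsub hi)] at hg
    rw [descentWeight_succ, hg.1 (p + 1) (by simp), if_neg (by omega), mul_comm]
  · rw [mul_ite, mul_zero, Finset.mul_sum]
    refine if_congr Iff.rfl (Finset.sum_congr rfl fun g hg => ?_) rfl
    rw [mem_antiSeqs ha] at hg
    rw [descentWeight_succ, descentWeight_shiftSeq, if_pos, mul_comm]
    simp [shiftSeq, hg.1 (p + 2) (by simp)]

theorem descentSeries_zero : descentSeries t a 0 0 = 1 := by
  ext d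
  have h : ∀ g, g ∈ antiSeqs a 0 d ↔ g = 0 ∧ d = 0 := by
    intro g
    rw [mem_antiSeqs (by simp), IsAntiSeq]
    simp only [zero_lt_one, Finset.Icc_eq_empty_of_lt, Finset.notMem_empty, not_false_eq_true,
      forall_const, IsEmpty.forall_iff, Finset.sum_empty, true_and]
    rw [funext_iff, eq_comm (a := 0)]
    rfl
  rw [descentSeries, PowerSeries.coeff_mk, PowerSeries.coeff_one]
  by_cases hd : d = 0
  · have : antiSeqs a 0 d = {0} := by
      ext g
      rw [h]
      simp [hd]
    rw [this, if_pos hd]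
    simp [descentWeight]
  · have : antiSeqs a 0 d = ∅ := by
      ext g
      simp [h, hd]
    simp [this, hd]

/-- The image of the generating series is a product. -/
theorem map_descentSeries {F : Type*} [Field F] (φ : R⟦X⟧ →+* F)
    (hq : ∀ n, 0 < n → 1 - φ PowerSeries.X ^ n ≠ 0) {p : ℕ}
    (ha : ∀ i ∈ Finset.Icc 1 p, 0 < a i) :
    φ (descentSeries t a p p) = ∏ i ∈ Finset.Icc 1 p,
      (φ PowerSeries.X ^ (∑ j ∈ Finset.Icc 1 i, a j) - φ (PowerSeries.C t) ^ a i) /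
        (1 - φ PowerSeries.X ^ (∑ j ∈ Finset.Icc 1 i, a j)) := by
  induction p with
  | zero => simp [descentSeries_zero]
  | succ p ih =>
    have hsub : Finset.Icc 1 p ⊆ Finset.Icc 1 (p + 1) := Finset.Icc_subset_Icc_right (by omega)
    -- Eliminating the series of type `(p + 1, p)` between the two relations multiplies the series
    -- by one more factor of the product.
    have h1 := congrArg φ (descentSeries_succ_left t ha)
    have h2 := congrArg φ (descentSeries_succ t ha)
    have h0 := hq _ (Finset.sum_pos ha ⟨1, by simp⟩)
    simp only [map_mul, map_sub, map_one, map_pow, map_add, map_neg] at h1 h2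
    rw [Finset.prod_Icc_succ_top (by omega), ← ih fun i hi => ha i (hsub hi), ← mul_div_assoc,
      eq_div_iff h0, h2, ← h1]
    ring

end Series

end WordQSym
namespace WordQSym

/-! ### The value of `M_w` at `𝕏` -/

theorem finite_list_length_sum (n d : ℕ) :
    {x : List ℕ | x.length = n ∧ x.sum = d}.Finite := by
  refine ((List.finite_length_eq (Fin (d + 1)) n).image (List.map Fin.val)).subset ?_
  rintro x ⟨hn, hd⟩
  have hle : ∀ a ∈ x, a < d + 1 := fun a ha => by
    have := List.le_sum_of_mem ha
    omega
  refine ⟨x.pmap (fun a h => ⟨a, h⟩) hle, by simpa using hn, ?_⟩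
  simp only [List.map_pmap]
  simp

/-- The finite set of words of length `n` and sum `d`. -/
noncomputable def wordsOfSum (n d : ℕ) : Finset (List ℕ) := (finite_list_length_sum n d).toFinset

theorem mem_wordsOfSum {n d : ℕ} {x : List ℕ} :
    x ∈ wordsOfSum n d ↔ x.length = n ∧ x.sum = d := by
  simp [wordsOfSum]

/-- A biword packing to `w` is an increasing substitution of biletters for the letters of `w`; `k`
and `f` are its two components, and the last condition is lexicographic increase. -/
theorem packPair_eq_iff {n : ℕ} {u v w : PackedWord} (hu : u ∈ PW n) (hv : v ∈ PW n) :
    packPair u v = w ↔ ∃ k f : ℕ → ℕ, u.1 = w.1.map k ∧ v.1 = w.1.map f ∧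
      ∀ i ∈ w.1, ∀ j ∈ w.1, i < j → k i < k j ∨ k i = k j ∧ f i < f j := by
  rw [mem_PW] at hu hv
  rw [packPair, pack_eq_iff]
  constructor
  · intro h
    obtain ⟨ψ, hψ, hz⟩ := exists_strictMonoOn_of_packList h
    refine ⟨fun i => (ofLex (ψ i)).1, fun i => (ofLex (ψ i)).2, ?_, ?_, fun i hi j hj hij =>
      Prod.Lex.lt_iff.1 (hψ hi hj hij)⟩
    · have h1 := congrArg (List.map fun z => (ofLex z).1) hz
      rw [List.map_zipWith, List.map_map] at h1
      refine Eq.trans ?_ h1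
      exact (List.map_fst_zip (l₁ := u.1) (l₂ := v.1) (by omega)).symm.trans List.map_zipWith
    · have h1 := congrArg (List.map fun z => (ofLex z).2) hz
      rw [List.map_zipWith, List.map_map] at h1
      refine Eq.trans ?_ h1
      exact (List.map_snd_zip (l₁ := u.1) (l₂ := v.1) (by omega)).symm.trans List.map_zipWith
  · rintro ⟨k, f, hk, hf, hmono⟩
    have hz : List.zipWith (fun a b => toLex (a, b)) u.1 v.1 =
        w.1.map fun i => toLex (k i, f i) := by
      rw [hk, hf, List.zipWith_map, List.zipWith_self]
    rw [hz]
    exact packList_map_of_isPacked w.2 _ fun i hi j hj hij =>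
      Prod.Lex.lt_iff.2 (hmono i hi j hj hij)

variable {R : Type*} [CommRing R]

/-- The series of `M_u` at 1/(1-q) counts the exponent words `x` packing to `u`, so summing over `u`
merges into one sum over all `x` of length `n` and sum `d`. -/
theorem principal_etaStar_coeff (t : R) {n : ℕ} {w : PackedWord} (hw : w ∈ PW n) (d : ℕ) :
    PowerSeries.coeff d (principal (etaStar t (M R w))) =
      ∑ x ∈ wordsOfSum n d, ∑ v ∈ (PW n).filter
        (fun v => packPair (pack (x.map OrderDual.toDual)) v = w),
          symEmbed R (sigmaOneSub t n) v := by
  have hw' := mem_PW.1 hw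
  rw [← basisM_apply, etaStar, Module.Basis.constr_basis, map_sum, map_sum, hw',
    ← Finset.sum_fiberwise_of_maps_to (s := wordsOfSum n d) (t := PW n)
      (g := fun x => pack (x.map OrderDual.toDual))]
  · refine Finset.sum_congr rfl fun u hu => ?_
    rw [map_smul, ← basisM_apply, principal, Module.Basis.constr_basis, PowerSeries.coeff_smul,
      principalM, PowerSeries.coeff_mk, eta_N_apply t hu]
    have hcard : Nat.card {x : List ℕ // pack (x.map OrderDual.toDual) = u ∧ x.sum = d} =
        ((wordsOfSum n d).filter fun x => pack (x.map OrderDual.toDual) = u).card := by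
      refine Nat.subtype_card _ fun x => ?_
      rw [Finset.mem_filter, mem_wordsOfSum]
      refine ⟨fun h => ⟨h.2, h.1.2⟩, fun h => ⟨⟨?_, h.2⟩, h.1⟩⟩
      rw [mem_PW, ← h.1] at hu
      simpa [pack] using hu
    rw [hcard, smul_eq_mul, mul_comm, ← nsmul_eq_mul, ← Finset.sum_const]
    exact Finset.sum_congr rfl fun x hx => by rw [(Finset.mem_filter.1 hx).2]
  · intro x hx
    rw [mem_wordsOfSum] at hx
    simp [pack, hx.1]

/-- The contribution of the words which are the images of the letters of `w` by `g`. -/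
theorem sum_packPair_map (t : R) {n : ℕ} (hn : 0 < n) {w : PackedWord} (hw : w ∈ PW n) {p d : ℕ}
    (hp : maxLetter w.1 = p + 1) {g : ℕ → ℕ} (hg : IsAntiSeq (w.1.count ·) (p + 1) d g) :
    ∑ v ∈ (PW n).filter
        (fun v => packPair (pack ((w.1.map g).map OrderDual.toDual)) v = w),
          symEmbed R (sigmaOneSub t n) v =
      (1 - t ^ Nmax w.1) * descentWeight t (w.1.count ·) p g := by
  have hlen := mem_PW.1 hw
  have hT : ∀ a, a ∈ w.1 ↔ a ∈ Finset.Icc 1 (p + 1) := fun a => by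
    rw [w.2.mem_iff, hp, Finset.mem_Icc]
  set z := (w.1.map g).map OrderDual.toDual with hz
  -- Ranks are taken in the reversed order on exponents, so `k` increases as `g` decreases, and `k`
  -- has the same fibres as `g` on the letters of `w`.
  set k : ℕ → ℕ := fun i => rank z (OrderDual.toDual (g i)) with hk
  have hzmem : ∀ i ∈ w.1, OrderDual.toDual (g i) ∈ z := fun i hi =>
    List.mem_map_of_mem (List.mem_map_of_mem hi)
  have hlt : ∀ i ∈ w.1, ∀ j ∈ w.1, k i < k j ↔ g j < g i := fun i hi j hj =>
    (rank_strictMonoOn z).lt_iff_lt (hzmem i hi) (hzmem j hj)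
  have heq : ∀ i ∈ w.1, ∀ j ∈ w.1, k i = k j ↔ g i = g j := fun i hi j hj =>
    ((rank_strictMonoOn z).injOn.eq_iff (hzmem i hi) (hzmem j hj)).trans
      OrderDual.toDual.injective.eq_iff
  have hu : (pack z).1 = w.1.map k := by
    show packList z = _
    rw [packList, hz, List.map_map, List.map_map]
    rfl
  have huPW : pack z ∈ PW n := by simp [pack, hz, hlen]
  have hsum := sum_PW_eq_sum_layerings hT k (fun v => packPair (pack z) v = w) (by
    intro v hv
    rw [hlen] at hv
    rw [packPair_eq_iff huPW hv]
    constructor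
    · rintro ⟨k', f, hk', hf, hmono⟩
      refine ⟨f, hf, fun i hi j hj hij hkij => ?_⟩
      have h := List.map_inj_left.1 (hu.symm.trans hk')
      rw [← hT] at hi hj
      have := hmono i hi j hj hij
      rw [← h i hi, ← h j hj] at this
      omega
    · rintro ⟨f, hf, hmono⟩
      refine ⟨k, f, hu, hf, fun i hi j hj hij => ?_⟩
      have h1 := hg.2.1 i ((hT i).1 hi) j ((hT j).1 hj) hij.le
      rw [hlt i hi j hj, heq i hi j hj]
      rcases h1.lt_or_eq with h | h
      · exact Or.inl h
      · exact Or.inr ⟨h.symm, hmono i ((hT i).1 hi) j ((hT j).1 hj) hij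
          ((heq i hi j hj).2 h.symm)⟩)
    (fun v => (-1 : R) ^ (maxLetter v + 1) * t ^ (n - Nmax v) * (1 - t ^ Nmax v))
  rw [hlen] at hsum
  rw [Finset.sum_congr rfl fun v hv => symEmbed_sigmaOneSub t hn (Finset.mem_filter.1 hv).1, hsum]
  have hmemT : ∀ a ∈ w.1, a ∈ Finset.Icc 1 (p + 1) := fun a ha => (hT a).1 ha
  have hcoef : ∀ f ∈ layerings k (Finset.Icc 1 (p + 1)),
      (-1 : R) ^ (maxLetter (w.1.map f) + 1) * t ^ (n - Nmax (w.1.map f)) *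
        (1 - t ^ Nmax (w.1.map f)) =
      (-1 : R) ^ ((Finset.Icc 1 (p + 1)).sup f + 1) *
        t ^ (∑ i ∈ Finset.Icc 1 (p + 1) \ topLayer (Finset.Icc 1 (p + 1)) f, w.1.count i) *
        (1 - t ^ (∑ i ∈ topLayer (Finset.Icc 1 (p + 1)) f, w.1.count i)) := by
    intro f _
    have h1 : Nmax (w.1.map f) = ∑ i ∈ topLayer (Finset.Icc 1 (p + 1)) f, w.1.count i := by
      rw [Nmax, count_map_eq_sum hmemT, maxLetter_map_eq_sup hT]
      rfl
    have h2 := length_eq_sum_count hmemT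
    have h3 : topLayer (Finset.Icc 1 (p + 1)) f ⊆ Finset.Icc 1 (p + 1) :=
      Finset.filter_subset _ _
    rw [← Finset.sum_sdiff h3, hlen] at h2
    rw [h1, maxLetter_map_eq_sup hT, ← h2, Nat.add_sub_cancel]
  rw [Finset.sum_congr rfl hcoef, sum_layerings_coeff t (w.1.count ·) k (by simp),
    Finset.prod_Icc_succ_top (by omega), mul_comm]
  congr 1
  -- The largest letter `p + 1` is always a fibre top, so it splits off the factor `1 - t ^ Nmax
  -- w.1`.
  · rw [if_pos, Nmax, hp]
    refine Finset.mem_filter.2 ⟨by simp, fun j hj hij => ?_⟩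
    rw [Finset.mem_Icc] at hj
    omega
  · refine Finset.prod_congr rfl fun i hi => ?_
    rw [Finset.mem_Icc] at hi
    have hi1 : i ∈ Finset.Icc 1 (p + 1) := Finset.mem_Icc.2 (by omega)
    have hi2 : i + 1 ∈ Finset.Icc 1 (p + 1) := Finset.mem_Icc.2 (by omega)
    refine if_congr ?_ rfl rfl
    rw [tops, Finset.mem_filter]
    constructor
    · intro h
      have h1 := h.2 (i + 1) hi2 (by omega)
      rw [Ne, heq i ((hT i).2 hi1) _ ((hT _).2 hi2)] at h1
      have h2 := hg.2.1 i hi1 (i + 1) hi2 (by omega)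
      omega
    -- As `g` is antitone, a strict descent right after `i` separates `i` from every later letter.
    · intro h
      refine ⟨hi1, fun j hj hij => ?_⟩
      rw [Ne, heq i ((hT i).2 hi1) _ ((hT _).2 hj)]
      have := hg.2.1 (i + 1) hi2 j hj hij
      omega

theorem principal_etaStar_M (t : R) {n : ℕ} (hn : 0 < n) {w : PackedWord} (hw : w ∈ PW n) {p : ℕ}
    (hp : maxLetter w.1 = p + 1) :
    principal (etaStar t (M R w)) =
      PowerSeries.C (1 - t ^ Nmax w.1) * descentSeries t (w.1.count ·) (p + 1) p := by
  have hlen := mem_PW.1 hw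
  have hT : ∀ a, a ∈ w.1 ↔ a ∈ Finset.Icc 1 (p + 1) := fun a => by
    rw [w.2.mem_iff, hp, Finset.mem_Icc]
  have ha : ∀ i ∈ Finset.Icc 1 (p + 1), 0 < w.1.count i := fun i hi =>
    List.count_pos_iff.2 ((hT i).2 hi)
  ext d
  rw [principal_etaStar_coeff t hw, PowerSeries.coeff_C_mul, descentSeries, PowerSeries.coeff_mk,
    Finset.mul_sum]
  symm
  refine Finset.sum_of_injOn (fun g => w.1.map g) ?_ ?_ ?_ ?_
  · intro g hg g' hg' h
    rw [Finset.mem_coe, mem_antiSeqs ha] at hg hg'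
    funext i
    by_cases hi : i ∈ Finset.Icc 1 (p + 1)
    · exact List.map_inj_left.1 h i ((hT i).2 hi)
    · rw [hg.1 i hi, hg'.1 i hi]
  · intro g hg
    rw [Finset.mem_coe, mem_antiSeqs ha] at hg
    rw [Finset.mem_coe, mem_wordsOfSum, List.length_map, sum_map_eq_sum_count fun a => (hT a).1]
    exact ⟨hlen, hg.2.2⟩
  -- A word `x` that is not `w` with an antitone sequence substituted admits no `v` at all.
  · intro x hx hx'
    rw [Finset.sum_eq_zero]
    intro v hv
    refine absurd ?_ hx'
    rw [mem_wordsOfSum] at hx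
    rw [Finset.mem_filter] at hv
    obtain ⟨hv, hpair⟩ := hv
    rw [packPair_eq_iff (n := n) (by simp [pack, hx.1]) hv] at hpair
    obtain ⟨k, f, hk, -, hmono⟩ := hpair
    obtain ⟨φ, hφ, hxφ⟩ := exists_strictMonoOn_of_packList
      (show packList (x.map OrderDual.toDual) = w.1.map k from hk)
    have hx1 : x = w.1.map fun i =>
        if i ∈ Finset.Icc 1 (p + 1) then OrderDual.ofDual (φ (k i)) else 0 := by
      have h := congrArg (List.map OrderDual.ofDual) hxφ
      rw [List.map_map, List.map_map, List.map_map] at h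
      rw [← List.map_id x]
      refine h.trans (List.map_congr_left fun i hi => ?_)
      rw [if_pos ((hT i).1 hi)]
      rfl
    refine ⟨_, ?_, hx1.symm⟩
    rw [Finset.mem_coe, mem_antiSeqs ha]
    refine ⟨fun i hi => if_neg hi, fun i hi j hj hij => ?_, ?_⟩
    · simp only [if_pos hi, if_pos hj]
      have hki := List.mem_map_of_mem (f := k) ((hT i).2 hi)
      have hkj := List.mem_map_of_mem (f := k) ((hT j).2 hj)
      have hkij : k i ≤ k j := by
        rcases hij.eq_or_lt with rfl | h
        · exact le_rfl
        · have := hmono i ((hT i).2 hi) j ((hT j).2 hj) h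
          omega
      exact (hφ.le_iff_le hki hkj).2 hkij
    · rw [← hx.2]
      conv_rhs => rw [hx1]
      rw [sum_map_eq_sum_count fun a => (hT a).1]
  · intro g hg
    rw [mem_antiSeqs ha] at hg
    exact (sum_packPair_map t hn hw hp hg).symm

/-! ### The closed form of M_w(𝕏) -/

/-- The product over the letters `1, …, m` of a word. -/
noncomputable def letterProd {F : Type*} [Field F] (q t : F) (w : List ℕ) (m : ℕ) : F :=
  ∏ k ∈ Finset.Icc 1 m, (q ^ (∑ j ∈ Finset.Icc 1 k, w.count j) - t ^ w.count k) /
    (1 - q ^ (∑ j ∈ Finset.Icc 1 k, w.count j))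

section Field

variable {K : Type*} [Field K]

theorem one_sub_q_pow_ne_zero {n : ℕ} (hn : 0 < n) : 1 - q K ^ n ≠ 0 := by
  intro h
  rw [q, ← map_pow, ← map_one (HahnSeries.ofPowerSeries ℤ (RatFunc K)), ← map_sub,
    map_eq_zero_iff _ HahnSeries.ofPowerSeries_injective] at h
  have := congrArg (PowerSeries.coeff 0) h
  simp [hn.ne'] at this

theorem one_sub_t_pow_ne_zero {n : ℕ} (hn : 0 < n) : 1 - t K ^ n ≠ 0 := by
  intro h
  rw [t, ← map_pow, ← map_one HahnSeries.C, ← map_sub,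
    map_eq_zero_iff _ HahnSeries.C_injective, sub_eq_zero, ← RatFunc.algebraMap_X, ← map_pow,
    ← map_one (algebraMap (Polynomial K) (RatFunc K)),
    (RatFunc.algebraMap_injective K).eq_iff] at h
  have := congrArg Polynomial.natDegree h
  simp at this
  omega

/-- The full multiplicity sum is the length `n`, so `descentSeries_succ_left` supplies the
denominator `1 - q ^ n`, and `map_descentSeries` the product over the letters below the maximum. -/
theorem atX_M {n : ℕ} (hn : 0 < n) {w : PackedWord} (hw : w ∈ PW n) :
    atX (M (RatFunc K) w) =
      (1 - t K ^ Nmax w.1) / (1 - q K ^ n) * letterProd (q K) (t K) w.1 (maxLetter w.1 - 1) := by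
  have hlen := mem_PW.1 hw
  have hne : w.1 ≠ [] := by
    intro h
    rw [h] at hlen
    exact hn.ne hlen
  obtain ⟨p, hp⟩ := Nat.exists_eq_add_of_le' (w.2.mem_iff.1 (maxLetter_mem hne)).1
  have hT : ∀ a, a ∈ w.1 ↔ a ∈ Finset.Icc 1 (p + 1) := fun a => by
    rw [w.2.mem_iff, hp, Finset.mem_Icc]
  have ha : ∀ i ∈ Finset.Icc 1 (p + 1), 0 < w.1.count i := fun i hi =>
    List.count_pos_iff.2 ((hT i).2 hi)
  have hC : ∀ r : RatFunc K, HahnSeries.ofPowerSeries ℤ (RatFunc K) (PowerSeries.C r) =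
      HahnSeries.C r := fun r => HahnSeries.ofPowerSeries_C r
  have h1 := congrArg (HahnSeries.ofPowerSeries ℤ (RatFunc K))
    (descentSeries_succ_left (RatFunc.X : RatFunc K) ha)
  have h2 := map_descentSeries (RatFunc.X : RatFunc K) (HahnSeries.ofPowerSeries ℤ (RatFunc K))
    (fun n hn => one_sub_q_pow_ne_zero hn) (p := p) fun i hi => ha i (by
      rw [Finset.mem_Icc] at hi ⊢
      omega)
  rw [h2, length_eq_sum_count fun a => (hT a).1, hlen] at h1
  rw [atX, principal_etaStar_M _ hn hw hp, map_mul, hC, div_mul_eq_mul_div,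
    eq_div_iff (one_sub_q_pow_ne_zero hn), hp, Nat.add_sub_cancel]
  simp only [map_mul, map_sub, map_one, map_pow, hC] at h1 ⊢
  rw [mul_assoc, mul_comm _ (1 - q K ^ n)]
  exact congrArg _ h1

end Field

end WordQSym
namespace WordQSym

/-! ### The partial products -/

section PartialProducts

variable {R : Type*} [CommRing R]

theorem partialMul_wordM (r : ℕ → ℕ → Prop) [DecidableRel r] {n m : ℕ} (hn : 0 < n) (hm : 0 < m)
    {u₁ u₂ : PackedWord} (h₁ : u₁ ∈ PW n) (h₂ : u₂ ∈ PW m) (w : List ℕ) :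
    partialMul r (wordM R u₁) (wordM R u₂) w =
      if w.length = n + m ∧ (pack (w.take n) = u₁ ∧ pack (w.drop n) = u₂) ∧
        r (maxLetter (w.take n)) (maxLetter (w.drop n)) then 1 else 0 := by
  rw [mem_PW] at h₁ h₂
  have hlen : ∀ {x : List ℕ} {u : PackedWord}, pack x = u → x.length = u.1.length := by
    rintro x _ rfl
    simp [pack]
  by_cases h : w.length = n + m
  · rw [partialMul, Finset.sum_eq_single n]
    · simp only [wordM, h, true_and, mul_ite, mul_one, mul_zero]
      split_ifs <;> simp_all
    · intro i hi hin
      rw [Finset.mem_Ioo] at hi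
      have : wordM R u₁ (w.take i) = 0 := if_neg fun h' => by
        have := hlen h'
        rw [List.length_take] at this
        omega
      simp [this]
    · intro h'
      exact absurd (Finset.mem_Ioo.2 (by omega)) h'
  · rw [if_neg fun h' => h h'.1, partialMul]
    refine Finset.sum_eq_zero fun i hi => ?_
    rw [Finset.mem_Ioo] at hi
    by_cases h3 : pack (w.take i) = u₁
    · have : wordM R u₂ (w.drop i) = 0 := if_neg fun h' => by
        have h4 := hlen h'
        have h5 := hlen h3
        rw [List.length_drop] at h4
        rw [List.length_take] at h5
        omega
      simp [this]
    · have : wordM R u₁ (w.take i) = 0 := if_neg h3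
      simp [this]

/-- An element of `WQSym` is determined by its values on packed words. -/
theorem eq_sum_M {f : WQSym R} {s : Finset PackedWord}
    (h1 : ∀ v ∈ s, f.1 v.1 = 1) (h0 : ∀ v, v ∉ s → f.1 v.1 = 0) : f = ∑ v ∈ s, M R v := by
  apply Subtype.ext
  funext w
  rw [← (mem_WQSym_iff.1 f.2).1 w, AddSubmonoidClass.coe_finsetSum, Finset.sum_apply]
  simp only [M, wordM, Finset.sum_ite_eq]
  split_ifs with h
  · exact h1 _ h
  · exact h0 _ h

end PartialProducts

theorem atX_sum {K : Type*} [Field K] {ι : Type*} (s : Finset ι) (f : ι → WQSym (RatFunc K)) :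
    atX (∑ i ∈ s, f i) = ∑ i ∈ s, atX (f i) := by
  simp only [atX, map_sum]

theorem prod_Icc_add {F : Type*} [CommMonoid F] (f : ℕ → F) (m n : ℕ) :
    ∏ i ∈ Finset.Icc 1 (m + n), f i =
      (∏ i ∈ Finset.Icc 1 m, f i) * ∏ i ∈ Finset.Icc 1 n, f (m + i) := by
  induction n with
  | zero => simp
  | succ n ih =>
    rw [← add_assoc, Finset.prod_Icc_succ_top (by omega), Finset.prod_Icc_succ_top (by omega), ih,
      mul_assoc]
    rfl

/-! ### Layerings of two chains -/

/-- The block function with blocks `{1, …, p}` and `{p + 1, …}`. -/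
def twoBlocks (p i : ℕ) : ℕ := if i ≤ p then 0 else 1

theorem twoBlocks_left {p i : ℕ} (hi : i ≤ p) : twoBlocks p i = 0 := if_pos hi

theorem twoBlocks_right {p i : ℕ} (hi : 0 < i) : twoBlocks p (p + i) = 1 := if_neg (by omega)

/-- The concatenation of `u₁` and of `u₂` shifted by `p`. -/
def shiftedConcat (p : ℕ) (u₁ u₂ : List ℕ) : List ℕ := u₁ ++ u₂.map (p + ·)

theorem tops_twoBlocks (r s : ℕ) :
    tops (twoBlocks (r + 1)) (Finset.Icc 1 (r + 1 + (s + 1))) = {r + 1, r + 1 + (s + 1)} := by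
  ext i
  rw [tops, Finset.mem_filter, Finset.mem_insert, Finset.mem_singleton, Finset.mem_Icc]
  constructor
  · rintro ⟨hi, h⟩
    by_contra! hcon
    by_cases hi' : i ≤ r + 1
    · refine h (i + 1) (Finset.mem_Icc.2 (by omega)) (by omega) ?_
      rw [twoBlocks, twoBlocks, if_pos (by omega), if_pos (by omega)]
    · refine h (i + 1) (Finset.mem_Icc.2 (by omega)) (by omega) ?_
      rw [twoBlocks, twoBlocks, if_neg (by omega), if_neg (by omega)]
  · intro h
    refine ⟨by omega, fun j hj hij => ?_⟩
    rw [Finset.mem_Icc] at hj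
    rw [twoBlocks, twoBlocks, if_pos (by omega), if_neg (by omega)]
    omega

/-- Only the two chain tops can be on the highest level, and at least one of them is, so comparing
their levels determines the highest level. -/
theorem topLayer_eq_iff {r s : ℕ} {f : ℕ → ℕ}
    (hf : IsLayering (twoBlocks (r + 1)) (Finset.Icc 1 (r + 1 + (s + 1))) f) {S : Finset ℕ}
    (hS : S ⊆ {r + 1, r + 1 + (s + 1)}) :
    topLayer (Finset.Icc 1 (r + 1 + (s + 1))) f = S ↔
      (r + 1 ∈ S ↔ f (r + 1 + (s + 1)) ≤ f (r + 1)) ∧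
      (r + 1 + (s + 1) ∈ S ↔ f (r + 1) ≤ f (r + 1 + (s + 1))) := by
  have hsub := hf.topLayer_subset
  rw [tops_twoBlocks] at hsub
  set T := Finset.Icc 1 (r + 1 + (s + 1)) with hT
  have h1 : r + 1 ∈ T := Finset.mem_Icc.2 (by omega)
  have h2 : r + 1 + (s + 1) ∈ T := Finset.mem_Icc.2 (by omega)
  have hle1 := Finset.le_sup (f := f) h1
  have hle2 := Finset.le_sup (f := f) h2
  have hmem1 : r + 1 ∈ topLayer T f ↔ f (r + 1) = T.sup f := by
    rw [topLayer, Finset.mem_filter, and_iff_right h1]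
  have hmem2 : r + 1 + (s + 1) ∈ topLayer T f ↔ f (r + 1 + (s + 1)) = T.sup f := by
    rw [topLayer, Finset.mem_filter, and_iff_right h2]
  have hor : f (r + 1) = T.sup f ∨ f (r + 1 + (s + 1)) = T.sup f := by
    obtain ⟨i, hi⟩ := topLayer_nonempty ⟨_, h1⟩ f
    have hi' := hsub hi
    rw [Finset.mem_insert, Finset.mem_singleton] at hi'
    rcases hi' with rfl | rfl
    · exact Or.inl (hmem1.1 hi)
    · exact Or.inr (hmem2.1 hi)
  have e1 : f (r + 1) = T.sup f ↔ f (r + 1 + (s + 1)) ≤ f (r + 1) := by omega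
  have e2 : f (r + 1 + (s + 1)) = T.sup f ↔ f (r + 1) ≤ f (r + 1 + (s + 1)) := by omega
  rw [← e1, ← e2, ← hmem1, ← hmem2]
  constructor
  · rintro rfl
    exact ⟨Iff.rfl, Iff.rfl⟩
  · rintro ⟨h3, h4⟩
    ext i
    by_cases hi1 : i = r + 1
    · rw [hi1, h3]
    by_cases hi2 : i = r + 1 + (s + 1)
    · rw [hi2, h4]
    · have hi : i ∉ ({r + 1, r + 1 + (s + 1)} : Finset ℕ) := by simp [hi1, hi2]
      exact ⟨fun h => absurd (hsub h) hi, fun h => absurd (hS h) hi⟩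

section ShiftedConcat

variable {u₁ u₂ : PackedWord} {r s : ℕ}

theorem mem_shiftedConcat (hr : maxLetter u₁.1 = r + 1) (hs : maxLetter u₂.1 = s + 1) (a : ℕ) :
    a ∈ shiftedConcat (r + 1) u₁.1 u₂.1 ↔ a ∈ Finset.Icc 1 (r + 1 + (s + 1)) := by
  rw [shiftedConcat, List.mem_append, u₁.2.mem_iff, List.mem_map, hr, Finset.mem_Icc]
  simp only [u₂.2.mem_iff, hs]
  constructor
  · rintro (h | ⟨b, hb, rfl⟩) <;> omega
  · intro h
    by_cases ha : a ≤ r + 1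
    · exact Or.inl ⟨h.1, ha⟩
    · exact Or.inr ⟨a - (r + 1), by omega, by omega⟩

theorem count_shiftedConcat_left {i : ℕ} (hi : i ≤ r + 1) :
    (shiftedConcat (r + 1) u₁.1 u₂.1).count i = u₁.1.count i := by
  rw [shiftedConcat, List.count_append, Nat.add_eq_left, List.count_eq_zero]
  intro h
  obtain ⟨b, hb, rfl⟩ := List.mem_map.1 h
  have := u₂.2.mem_iff.1 hb
  omega

theorem count_shiftedConcat_right (hr : maxLetter u₁.1 = r + 1) {i : ℕ} (hi : 0 < i) :
    (shiftedConcat (r + 1) u₁.1 u₂.1).count (r + 1 + i) = u₂.1.count i := by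
  rw [shiftedConcat, List.count_append,
    List.count_map_of_injective _ _ (add_right_injective (r + 1)), Nat.add_eq_right,
    List.count_eq_zero]
  intro h
  have := u₁.2.mem_iff.1 h
  omega

theorem fibreSum_left {i : ℕ} (hi : i ≤ r + 1) :
    fibreSum (twoBlocks (r + 1)) ((shiftedConcat (r + 1) u₁.1 u₂.1).count ·)
      (Finset.Icc 1 (r + 1 + (s + 1))) i = ∑ j ∈ Finset.Icc 1 i, u₁.1.count j := by
  have : (Finset.Icc 1 (r + 1 + (s + 1))).filter
      (fun j => j ≤ i ∧ twoBlocks (r + 1) j = twoBlocks (r + 1) i) = Finset.Icc 1 i := by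
    ext j
    simp only [Finset.mem_filter, Finset.mem_Icc, twoBlocks, if_pos hi]
    constructor
    · intro h
      omega
    · intro h
      rw [if_pos (by omega)]
      omega
  rw [fibreSum, this]
  refine Finset.sum_congr rfl fun j hj => count_shiftedConcat_left ?_
  exact (Finset.mem_Icc.1 hj).2.trans hi

theorem fibreSum_right (hr : maxLetter u₁.1 = r + 1) {i : ℕ} (hi : 0 < i) (hi' : i ≤ s + 1) :
    fibreSum (twoBlocks (r + 1)) ((shiftedConcat (r + 1) u₁.1 u₂.1).count ·)
      (Finset.Icc 1 (r + 1 + (s + 1))) (r + 1 + i) = ∑ j ∈ Finset.Icc 1 i, u₂.1.count j := by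
  have : (Finset.Icc 1 (r + 1 + (s + 1))).filter
      (fun j => j ≤ r + 1 + i ∧ twoBlocks (r + 1) j = twoBlocks (r + 1) (r + 1 + i)) =
      (Finset.Icc 1 i).image (r + 1 + ·) := by
    ext j
    rw [Finset.mem_filter, Finset.mem_image, twoBlocks_right hi, Finset.mem_Icc, twoBlocks]
    simp only [Finset.mem_Icc]
    constructor
    · intro h
      by_cases hj : j ≤ r + 1
      · rw [if_pos hj] at h
        omega
      · exact ⟨j - (r + 1), by omega, by omega⟩
    · rintro ⟨b, hb, rfl⟩
      rw [if_neg (by omega)]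
      omega
  rw [fibreSum, this, Finset.sum_image (by simp)]
  refine Finset.sum_congr rfl fun j hj => count_shiftedConcat_right hr ?_
  exact (Finset.mem_Icc.1 hj).1

/-- The fibre sums along a block are the partial sums of multiplicities of the corresponding factor.
Below the chain tops this gives `letterProd`; at a top outside `S` the partial sum is the full
length, whence the factor in `n` or `m`. -/
theorem prod_sdiff_shiftedConcat {F : Type*} [Field F] (q t : F) {n m : ℕ} (h₁ : u₁ ∈ PW n)
    (h₂ : u₂ ∈ PW m) (hr : maxLetter u₁.1 = r + 1) (hs : maxLetter u₂.1 = s + 1) {S : Finset ℕ}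
    (hS : S ⊆ {r + 1, r + 1 + (s + 1)}) (a b : ℕ → ℕ)
    (ha : a = fun i => (shiftedConcat (r + 1) u₁.1 u₂.1).count i)
    (hb : b = fibreSum (twoBlocks (r + 1)) a (Finset.Icc 1 (r + 1 + (s + 1)))) :
    ∏ i ∈ Finset.Icc 1 (r + 1 + (s + 1)) \ S, (q ^ b i - t ^ a i) / (1 - q ^ b i) =
      (letterProd q t u₁.1 r *
        if r + 1 ∈ S then 1 else (q ^ n - t ^ Nmax u₁.1) / (1 - q ^ n)) *
      (letterProd q t u₂.1 s *
        if r + 1 + (s + 1) ∈ S then 1 else (q ^ m - t ^ Nmax u₂.1) / (1 - q ^ m)) := by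
  have hnot : ∀ i, i ≠ r + 1 → i ≠ r + 1 + (s + 1) → i ∉ S := fun i h1 h2 h => by
    simpa [h1, h2] using hS h
  have hsum1 := length_eq_sum_count (w := u₁.1) (T := Finset.Icc 1 (r + 1)) fun a ha => by
    rw [Finset.mem_Icc, ← hr]
    exact u₁.2.mem_iff.1 ha
  have hsum2 := length_eq_sum_count (w := u₂.1) (T := Finset.Icc 1 (s + 1)) fun a ha => by
    rw [Finset.mem_Icc, ← hs]
    exact u₂.2.mem_iff.1 ha
  rw [mem_PW] at h₁ h₂
  have ha1 : ∀ i ≤ r + 1, a i = u₁.1.count i := fun i hi => by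
    rw [ha]
    exact count_shiftedConcat_left hi
  have ha2 : ∀ i, 0 < i → a (r + 1 + i) = u₂.1.count i := fun i hi => by
    rw [ha]
    exact count_shiftedConcat_right hr hi
  have hb1 : ∀ i ≤ r + 1, b i = ∑ j ∈ Finset.Icc 1 i, u₁.1.count j := fun i hi => by
    rw [hb, ha]
    exact fibreSum_left hi
  have hb2 : ∀ i, 0 < i → i ≤ s + 1 → b (r + 1 + i) = ∑ j ∈ Finset.Icc 1 i, u₂.1.count j :=
    fun i hi hi' => by
      rw [hb, ha]
      exact fibreSum_right hr hi hi'
  rw [Finset.sdiff_eq_filter, Finset.prod_filter, prod_Icc_add,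
    Finset.prod_Icc_succ_top (by omega), Finset.prod_Icc_succ_top (by omega)]
  simp only [ite_not]
  rw [ha1 _ le_rfl, hb1 _ le_rfl, ha2 _ (by omega), hb2 _ (by omega) le_rfl, hsum1, hsum2, h₁, h₂,
    Nmax, Nmax, hr, hs]
  congr 2
  · refine Finset.prod_congr rfl fun i hi => ?_
    rw [Finset.mem_Icc] at hi
    rw [if_neg (hnot i (by omega) (by omega)), ha1 i (by omega), hb1 i (by omega)]
  · refine Finset.prod_congr rfl fun i hi => ?_
    rw [Finset.mem_Icc] at hi
    rw [if_neg (hnot _ (by omega) (by omega)), ha2 i (by omega), hb2 i (by omega) (by omega)]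

theorem take_map_shiftedConcat {n : ℕ} (h₁ : u₁ ∈ PW n) (f : ℕ → ℕ) :
    ((shiftedConcat (r + 1) u₁.1 u₂.1).map f).take n = u₁.1.map f := by
  rw [shiftedConcat, List.map_append, List.take_left' (by rw [List.length_map, mem_PW.1 h₁])]

theorem drop_map_shiftedConcat {n : ℕ} (h₁ : u₁ ∈ PW n) (f : ℕ → ℕ) :
    ((shiftedConcat (r + 1) u₁.1 u₂.1).map f).drop n = u₂.1.map fun i => f (r + 1 + i) := by
  rw [shiftedConcat, List.map_append, List.drop_left' (by rw [List.length_map, mem_PW.1 h₁]),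
    List.map_map]
  rfl

theorem strictMonoOn_left (hr : maxLetter u₁.1 = r + 1) {f : ℕ → ℕ}
    (hf : ∀ i ∈ Finset.Icc 1 (r + 1 + (s + 1)), ∀ j ∈ Finset.Icc 1 (r + 1 + (s + 1)), i < j →
      twoBlocks (r + 1) i = twoBlocks (r + 1) j → f i < f j) :
    StrictMonoOn f {a | a ∈ u₁.1} := by
  intro i hi j hj hij
  have hi' := u₁.2.mem_iff.1 hi
  have hj' := u₁.2.mem_iff.1 hj
  refine hf i (Finset.mem_Icc.2 (by omega)) j (Finset.mem_Icc.2 (by omega)) hij ?_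
  rw [twoBlocks_left (by omega), twoBlocks_left (by omega)]

theorem strictMonoOn_right (hs : maxLetter u₂.1 = s + 1) {f : ℕ → ℕ}
    (hf : ∀ i ∈ Finset.Icc 1 (r + 1 + (s + 1)), ∀ j ∈ Finset.Icc 1 (r + 1 + (s + 1)), i < j →
      twoBlocks (r + 1) i = twoBlocks (r + 1) j → f i < f j) :
    StrictMonoOn (fun i => f (r + 1 + i)) {a | a ∈ u₂.1} := by
  intro i hi j hj hij
  have hi' := u₂.2.mem_iff.1 hi
  have hj' := u₂.2.mem_iff.1 hj
  refine hf _ (Finset.mem_Icc.2 (by omega)) _ (Finset.mem_Icc.2 (by omega)) (by omega) ?_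
  rw [twoBlocks_right (by omega), twoBlocks_right (by omega)]

/-- Each factor is an increasing substitution in its packed word; shifting the letters of `u₂` lets
one map `f` carry both substitutions, with no condition between the blocks. -/
theorem pack_take_drop_iff {n : ℕ} (h₁ : u₁ ∈ PW n) (hr : maxLetter u₁.1 = r + 1)
    (hs : maxLetter u₂.1 = s + 1) (v : List ℕ) :
    pack (v.take n) = u₁ ∧ pack (v.drop n) = u₂ ↔
      ∃ f : ℕ → ℕ, v = (shiftedConcat (r + 1) u₁.1 u₂.1).map f ∧
        ∀ i ∈ Finset.Icc 1 (r + 1 + (s + 1)), ∀ j ∈ Finset.Icc 1 (r + 1 + (s + 1)), i < j →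
          twoBlocks (r + 1) i = twoBlocks (r + 1) j → f i < f j := by
  constructor
  · rintro ⟨ht, hd⟩
    obtain ⟨φ, hφ, hvφ⟩ := exists_strictMonoOn_of_packList (pack_eq_iff.1 ht)
    obtain ⟨ψ, hψ, hvψ⟩ := exists_strictMonoOn_of_packList (pack_eq_iff.1 hd)
    refine ⟨fun i => if i ≤ r + 1 then φ i else ψ (i - (r + 1)), ?_, fun i hi j hj hij hg => ?_⟩
    · rw [← List.take_append_drop n v, hvφ, hvψ, shiftedConcat, List.map_append, List.map_map]
      congr 1
      · refine List.map_congr_left fun i hi => ?_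
        have := u₁.2.mem_iff.1 hi
        rw [if_pos (by omega)]
      · refine List.map_congr_left fun i hi => ?_
        have := u₂.2.mem_iff.1 hi
        simp only [Function.comp]
        rw [if_neg (by omega), Nat.add_sub_cancel_left]
    · rw [Finset.mem_Icc] at hi hj
      by_cases hj' : j ≤ r + 1
      · simp only [if_pos (by omega : i ≤ r + 1), if_pos hj']
        exact hφ (u₁.2.mem_iff.2 (by omega)) (u₁.2.mem_iff.2 (by omega)) hij
      · by_cases hi' : i ≤ r + 1
        · rw [twoBlocks, twoBlocks, if_pos hi', if_neg hj'] at hg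
          omega
        · simp only [if_neg hi', if_neg hj']
          exact hψ (u₂.2.mem_iff.2 (by omega)) (u₂.2.mem_iff.2 (by omega)) (by omega)
  · rintro ⟨f, rfl, hf⟩
    rw [take_map_shiftedConcat h₁, drop_map_shiftedConcat h₁, pack_eq_iff, pack_eq_iff]
    exact ⟨packList_map_of_isPacked u₁.2 _ (strictMonoOn_left hr hf),
      packList_map_of_isPacked u₂.2 _ (strictMonoOn_right hs hf)⟩

end ShiftedConcat

/-- The letters at most `k` in the substituted word come from the elements of `T` on levels `1` to
`k`; positivity of the levels excludes `0`. -/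
theorem letterProd_map {F : Type*} [Field F] (q t : F) {ω : List ℕ} {T : Finset ℕ}
    (hT : ∀ a, a ∈ ω ↔ a ∈ T) {g f : ℕ → ℕ} (hf : IsLayering g T f) (m : ℕ) :
    letterProd q t (ω.map f) m = layerProd q t (ω.count ·) T f m := by
  have hmem : ∀ a ∈ ω, a ∈ T := fun a => (hT a).1
  refine Finset.prod_congr rfl fun k _ => ?_
  have h1 : ∑ j ∈ Finset.Icc 1 k, (ω.map f).count j = ∑ i ∈ T.filter (f · ≤ k), ω.count i := by
    rw [← Finset.sum_fiberwise_of_maps_to (s := T.filter (f · ≤ k)) (t := Finset.Icc 1 k) (g := f)]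
    · refine Finset.sum_congr rfl fun j hj => ?_
      rw [count_map_eq_sum hmem, Finset.filter_filter]
      refine Finset.sum_congr (Finset.filter_congr fun i _ => ?_) fun _ _ => rfl
      rw [Finset.mem_Icc] at hj
      omega
    · intro i hi
      rw [Finset.mem_filter] at hi
      exact Finset.mem_Icc.2 ⟨hf.2.1 i hi.1, hi.2⟩
  rw [h1, count_map_eq_sum hmem]

/-- The value at `𝕏` of a partial product, in terms of the set `S` of those of the maximal letters
of the two factors which are maximal in the product. -/
theorem atX_partialMul {K : Type*} [Field K] {n m : ℕ} (hn : 0 < n) (hm : 0 < m)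
    {u₁ u₂ : PackedWord} (h₁ : u₁ ∈ PW n) (h₂ : u₂ ∈ PW m) {r s : ℕ}
    (hr : maxLetter u₁.1 = r + 1) (hs : maxLetter u₂.1 = s + 1)
    (ρ : ℕ → ℕ → Prop) [DecidableRel ρ] (F : WQSym (RatFunc K))
    (hF : F.1 = partialMul ρ (wordM (RatFunc K) u₁) (wordM (RatFunc K) u₂)) {S : Finset ℕ}
    (hne : S.Nonempty) (hS : S ⊆ {r + 1, r + 1 + (s + 1)})
    (hρ : ∀ x y, ρ x y ↔ (r + 1 ∈ S ↔ y ≤ x) ∧ (r + 1 + (s + 1) ∈ S ↔ x ≤ y)) :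
    atX F = (1 - t K ^ (∑ i ∈ S, (shiftedConcat (r + 1) u₁.1 u₂.1).count i)) /
        (1 - q K ^ (n + m)) *
      ((letterProd (q K) (t K) u₁.1 r *
        if r + 1 ∈ S then 1 else (q K ^ n - t K ^ Nmax u₁.1) / (1 - q K ^ n)) *
      (letterProd (q K) (t K) u₂.1 s *
        if r + 1 + (s + 1) ∈ S then 1 else (q K ^ m - t K ^ Nmax u₂.1) / (1 - q K ^ m))) := by
  classical
  set ω := shiftedConcat (r + 1) u₁.1 u₂.1 with hω
  set T := Finset.Icc 1 (r + 1 + (s + 1)) with hTdef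
  have hT : ∀ a, a ∈ ω ↔ a ∈ T := mem_shiftedConcat hr hs
  have hmem : ∀ a ∈ ω, a ∈ T := fun a => (hT a).1
  have hlen : ω.length = n + m := by
    rw [hω, shiftedConcat, List.length_append, List.length_map, mem_PW.1 h₁, mem_PW.1 h₂]
  have htops : S ⊆ tops (twoBlocks (r + 1)) T := by rwa [tops_twoBlocks]
  have hST : S ⊆ T := htops.trans (tops_subset _ _)
  set P : PackedWord → Prop := fun v => pack (v.1.take n) = u₁ ∧ pack (v.1.drop n) = u₂ with hP
  set Ψ : List ℕ → (RatFunc K)⸨X⸩ := fun v =>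
    if ρ (maxLetter (v.take n)) (maxLetter (v.drop n)) then
      (1 - t K ^ Nmax v) / (1 - q K ^ (n + m)) * letterProd (q K) (t K) v (maxLetter v - 1)
    else 0 with hΨ
  have hFsum : F = ∑ v ∈ (PW (n + m)).filter
      (fun v => P v ∧ ρ (maxLetter (v.1.take n)) (maxLetter (v.1.drop n))), M (RatFunc K) v := by
    refine eq_sum_M (fun v hv => ?_) (fun v hv => ?_)
    · rw [Finset.mem_filter, mem_PW] at hv
      rw [hF, partialMul_wordM ρ hn hm h₁ h₂, if_pos hv]
    · rw [Finset.mem_filter, mem_PW] at hv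
      rw [hF, partialMul_wordM ρ hn hm h₁ h₂, if_neg hv]
  have h1 : atX F = ∑ v ∈ (PW (n + m)).filter P, Ψ v.1 := by
    rw [hFsum, atX_sum, ← Finset.filter_filter, Finset.sum_filter]
    refine Finset.sum_congr rfl fun v hv => ?_
    rw [atX_M (by omega) (Finset.mem_filter.1 hv).1]
  have h2 := sum_PW_eq_sum_layerings hT (twoBlocks (r + 1)) P
    (fun v _ => pack_take_drop_iff h₁ hr hs v.1) Ψ
  rw [hlen] at h2
  have hmax : ∀ f ∈ layerings (twoBlocks (r + 1)) T,
      (ρ (maxLetter ((ω.map f).take n)) (maxLetter ((ω.map f).drop n)) ↔ topLayer T f = S) := by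
    intro f hf
    rw [mem_layerings] at hf
    have hne1 : u₁.1 ≠ [] := by
      intro h
      rw [mem_PW, h] at h₁
      exact hn.ne h₁
    have hne2 : u₂.1 ≠ [] := by
      intro h
      rw [mem_PW, h] at h₂
      exact hm.ne h₂
    rw [take_map_shiftedConcat h₁, drop_map_shiftedConcat h₁,
      maxLetter_map hne1 _ (strictMonoOn_left hr hf.2.2.2),
      maxLetter_map hne2 _ (strictMonoOn_right hs hf.2.2.2), hr, hs, topLayer_eq_iff hf hS, hρ]
  have h3 : ∑ f ∈ layerings (twoBlocks (r + 1)) T, Ψ (ω.map f) =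
      ∑ f ∈ (layerings (twoBlocks (r + 1)) T).filter (fun f => topLayer T f = S),
        (1 - t K ^ Nmax (ω.map f)) / (1 - q K ^ (n + m)) *
          letterProd (q K) (t K) (ω.map f) (maxLetter (ω.map f) - 1) := by
    rw [Finset.sum_filter]
    refine Finset.sum_congr rfl fun f hf => ?_
    exact if_congr (hmax f hf) rfl rfl
  -- With the highest level fixed as `S`, the sum runs over layerings of `T \ S`, and the factor of
  -- the maximal letter becomes constant.
  rw [h1, h2, h3, sum_layerings_topLayer_eq htops hne]
  have h4 : ∀ f ∈ layerings (twoBlocks (r + 1)) (T \ S),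
      (1 - t K ^ Nmax (ω.map (addTop T S f))) / (1 - q K ^ (n + m)) *
          letterProd (q K) (t K) (ω.map (addTop T S f)) (maxLetter (ω.map (addTop T S f)) - 1) =
      (1 - t K ^ (∑ i ∈ S, ω.count i)) / (1 - q K ^ (n + m)) *
        layerProd (q K) (t K) (ω.count ·) (T \ S) f ((T \ S).sup f) := by
    intro f hf
    rw [mem_layerings] at hf
    have h5 : Nmax (ω.map (addTop T S f)) = ∑ i ∈ S, ω.count i := by
      rw [Nmax, count_map_eq_sum hmem, maxLetter_map_eq_sup hT]
      exact congrArg (fun s => ∑ i ∈ s, ω.count i) (topLayer_addTop hST hne)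
    rw [h5, letterProd_map _ _ hT (hf.addTop htops), maxLetter_map_eq_sup hT, sup_addTop hST hne,
      Nat.add_sub_cancel, layerProd_addTop_sup]
  rw [Finset.sum_congr rfl h4, ← Finset.mul_sum,
    sum_layerProd (q K) (t K) (fun _ => one_sub_q_pow_ne_zero) _ _ _ fun i hi =>
      List.count_pos_iff.2 ((hT i).2 (Finset.mem_sdiff.1 hi).1)]
  rw [Finset.prod_congr rfl fun i hi => by rw [fibreSum_sdiff _ htops hi]]
  rw [prod_sdiff_shiftedConcat (q K) (t K) h₁ h₂ hr hs hS _ _ rfl rfl]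

end WordQSym

/-! ### The three formulas -/

theorem mainTheorem11 (K : Type*) [Field K] (n m : ℕ) (hn : 0 < n) (hm : 0 < m)
    (u₁ u₂ : WordQSym.PackedWord) (h₁ : u₁ ∈ WordQSym.PW n) (h₂ : u₂ ∈ WordQSym.PW m) :
    WordQSym.atX (WordQSym.prec (WordQSym.M (RatFunc K) u₁) (WordQSym.M (RatFunc K) u₂)) =
        (1 - WordQSym.q K ^ n) / (1 - WordQSym.q K ^ (n + m)) *
          ((WordQSym.q K ^ m - WordQSym.t K ^ WordQSym.Nmax u₂.1) /
            (1 - WordQSym.t K ^ WordQSym.Nmax u₂.1)) *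
          (WordQSym.atX (WordQSym.M (RatFunc K) u₁) * WordQSym.atX (WordQSym.M (RatFunc K) u₂)) ∧
    WordQSym.atX (WordQSym.mid (WordQSym.M (RatFunc K) u₁) (WordQSym.M (RatFunc K) u₂)) =
        (1 - WordQSym.q K ^ n) * (1 - WordQSym.q K ^ m) / (1 - WordQSym.q K ^ (n + m)) *
          ((1 - WordQSym.t K ^ (WordQSym.Nmax u₁.1 + WordQSym.Nmax u₂.1)) /
            ((1 - WordQSym.t K ^ WordQSym.Nmax u₁.1) *
              (1 - WordQSym.t K ^ WordQSym.Nmax u₂.1))) *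
          (WordQSym.atX (WordQSym.M (RatFunc K) u₁) * WordQSym.atX (WordQSym.M (RatFunc K) u₂)) ∧
    WordQSym.atX (WordQSym.succ (WordQSym.M (RatFunc K) u₁) (WordQSym.M (RatFunc K) u₂)) =
        (1 - WordQSym.q K ^ m) / (1 - WordQSym.q K ^ (n + m)) *
          ((WordQSym.q K ^ n - WordQSym.t K ^ WordQSym.Nmax u₁.1) /
            (1 - WordQSym.t K ^ WordQSym.Nmax u₁.1)) *
          (WordQSym.atX (WordQSym.M (RatFunc K) u₁) * WordQSym.atX (WordQSym.M (RatFunc K) u₂)) := by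
  have hpos : ∀ {k : ℕ} {u : WordQSym.PackedWord}, 0 < k → u ∈ WordQSym.PW k →
      0 < WordQSym.maxLetter u.1 ∧ 0 < WordQSym.Nmax u.1 := by
    intro k u hk hu
    have hne : u.1 ≠ [] := by
      intro h
      rw [WordQSym.mem_PW, h] at hu
      exact hk.ne hu
    exact ⟨(u.2.mem_iff.1 (WordQSym.maxLetter_mem hne)).1,
      List.count_pos_iff.2 (WordQSym.maxLetter_mem hne)⟩
  obtain ⟨r, hr⟩ := Nat.exists_eq_add_of_le' (hpos hn h₁).1
  obtain ⟨s, hs⟩ := Nat.exists_eq_add_of_le' (hpos hm h₂).1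
  have hc1 : (WordQSym.shiftedConcat (r + 1) u₁.1 u₂.1).count (r + 1) = WordQSym.Nmax u₁.1 := by
    rw [WordQSym.count_shiftedConcat_left le_rfl, WordQSym.Nmax, hr]
  have hc2 : (WordQSym.shiftedConcat (r + 1) u₁.1 u₂.1).count (r + 1 + (s + 1)) =
      WordQSym.Nmax u₂.1 := by
    rw [WordQSym.count_shiftedConcat_right hr (Nat.succ_pos s), WordQSym.Nmax, hs]
  have hne : r + 1 ≠ r + 1 + (s + 1) := by omega
  have hqn := WordQSym.one_sub_q_pow_ne_zero (K := K) hn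
  have hqm := WordQSym.one_sub_q_pow_ne_zero (K := K) hm
  have hqnm := WordQSym.one_sub_q_pow_ne_zero (K := K) (Nat.add_pos_left hn m)
  have ht1 := WordQSym.one_sub_t_pow_ne_zero (K := K) (hpos hn h₁).2
  have ht2 := WordQSym.one_sub_t_pow_ne_zero (K := K) (hpos hm h₂).2
  rw [WordQSym.atX_M hn h₁, WordQSym.atX_M hm h₂, hr, hs, Nat.add_sub_cancel, Nat.add_sub_cancel]
  refine ⟨?_, ?_, ?_⟩
  -- The set `S` holds the chain tops reaching the maximum: only that of `u₁` here, both for `∘`,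
  -- only that of `u₂` for `≻`. The letter products match on both sides, so only the factors `1 - q
  -- ^ _` and `1 - t ^ _` are cancelled.
  · rw [WordQSym.atX_partialMul hn hm h₁ h₂ hr hs (· > ·) _ rfl (S := {r + 1}) (by simp) (by simp)
      (fun x y => by simp; omega), Finset.sum_singleton, hc1, if_pos (by simp), if_neg (by simp)]
    field_simp
  · rw [WordQSym.atX_partialMul hn hm h₁ h₂ hr hs (· = ·) _ rfl (S := {r + 1, r + 1 + (s + 1)})
      (by simp) subset_rfl (fun x y => by simp; omega), Finset.sum_pair hne, hc1, hc2,
      if_pos (by simp), if_pos (by simp)]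
    field_simp
  · rw [WordQSym.atX_partialMul hn hm h₁ h₂ hr hs (· < ·) _ rfl (S := {r + 1 + (s + 1)}) (by simp)
      (by simp) (fun x y => by simp; omega), Finset.sum_singleton, hc2, if_neg (by simp),
      if_pos (by simp)]
    field_simp
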